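/- Let $G$ be a second countable, locally compact Hausdorff groupoid with unit space $G^0$, range and source maps $r,s$, and a left Haar system $u\mapsto\lambda^u$ (with $\lambda^u$ supported on $G^u=r^{-1}(u)$); let $\lambda_u$ be the image of $\lambda^u$ under inversion (a measure on $G_u=s^{-1}(u)$) and let $D=C_0(G^0)$. On $C_c(G)$ put $f*g(x)=\int f(t)g(t^{-1}x)\,d\lambda^{r(x)}(t)$, $F^*(x)=\overline{F(x^{-1})}$, $F^\vee(x)=F(x^{-1})$, and $\|F\|_I=\max\{\sup_u\int|F|\,d\lambda^u,\ \sup_u\int|F|\,d\lambda_u\}$. Let $E^2$ be the Hilbert $D$-module of continuous sections vanishing at infinity of the bundle $\{L^2(G^u,\lambda^u)\}_{u\in G^0}$, where a section is continuous if it is locally uniformly approximable by sections $u\mapsto f|_{G^u}$, $f\in C_c(G)$; the norm is $\|\xi\|=\sup_u\|\xi^u\|$, the action is $(\xi b)^u=b(u)\xi^u$, the inner product is $\langle\xi,\eta\rangle(u)=(\xi^u,\eta^u)$ (conjugate linear in the first variable), and $C_c(G)\subset E^2$. Let $\mathfrak L(E^2)$ be the algebra of adjointable operators on $E^2$ with the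 operator norm. Let $\pi_u(F)\xi(x)=\int F(t)\xi(t^{-1}x)\,d\lambda^{r(x)}(t)$ be the regular representation of $C_c(G)$ on $L^2(G_u,\lambda_u)$, let $\|F\|_{red}=\sup_u\|\pi_u(F)\|$, and let $C^*_{red}(G)$ be the C*-algebra obtained by completing $(C_c(G),\|\cdot\|_{red})$. Then there is a linear map $F\mapsto R_F$ from $C_c(G)$ to $\mathfrak L(E^2)$ such that, for all $F,F',f\in C_c(G)$: 1. $R_F$ extends right convolution by $F$, that is, $R_Ff=f*F$; 2. $\|R_F\|\le\|F\|_I$; 3. $R_{F*F'}=R_{F'}R_F$ and $R_{F^*}=(R_F)^*$ (so $F\mapsto R_F$ is a $*$-antirepresentation); 4. $\|R_F\|=\|F\|_{red}$, and there is an isometric $*$-homomorphism $\Phi:C^*_{red}(G)\to\mathfrak L(E^2)$ whose range is the norm closure of $\{R_F:F\in C_c(G)\}$ and which satisfies $\Phi(F)=R_{F^\vee}$ for $F\in C_c(G)$; thus this closure is canonically $*$-isomorphic to $C^*_{red}(G)$. -/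

import Mathlib

open MeasureTheory Filter Topology CompactlySupported ZeroAtInfty
open scoped ENNReal NNReal

set_option linter.unusedSectionVars false

/-- A topological groupoid with space of arrows `G` and unit space `X` (embedded in `G` by `unit`,
which is a homeomorphism onto its image since `r ∘ unit = id`). The product `mul x y` is only
meaningful when `s x = r y`: no axiom mentions its value at other pairs, and nothing below
depends on it. -/
structure TopGroupoid (X G : Type*) [TopologicalSpace X] [TopologicalSpace G] where
  r : G → X
  s : G → X
  unit : X → G
  inv : G → G
  mul : G → G → G
  r_unit : ∀ u, r (unit u) = u
  s_unit : ∀ u, s (unit u) = u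
  r_inv : ∀ x, r (inv x) = s x
  s_inv : ∀ x, s (inv x) = r x
  r_mul : ∀ x y, s x = r y → r (mul x y) = r x
  s_mul : ∀ x y, s x = r y → s (mul x y) = s y
  mul_assoc : ∀ x y z, s x = r y → s y = r z → mul (mul x y) z = mul x (mul y z)
  unit_mul : ∀ x, mul (unit (r x)) x = x
  mul_unit : ∀ x, mul x (unit (s x)) = x
  inv_mul : ∀ x, mul (inv x) x = unit (s x)
  mul_inv : ∀ x, mul x (inv x) = unit (r x)
  continuous_r : Continuous r
  continuous_s : Continuous s
  continuous_unit : Continuous unit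
  continuous_inv : Continuous inv
  continuousOn_mul : ContinuousOn (fun p : G × G => mul p.1 p.2) {p | s p.1 = r p.2}

namespace TopGroupoid

variable {X G : Type*} [TopologicalSpace X] [TopologicalSpace G] (𝒢 : TopGroupoid X G)

theorem t2Space_unit {X G : Type*} [TopologicalSpace X] [TopologicalSpace G]
    (𝒢 : TopGroupoid X G) [T2Space G] : T2Space X :=
  T2Space.of_injective_continuous (f := 𝒢.unit)
    (Function.LeftInverse.injective (g := 𝒢.r) 𝒢.r_unit) 𝒢.continuous_unit

theorem inv_inv (x : G) : 𝒢.inv (𝒢.inv x) = x := by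
  have h := 𝒢.mul_assoc (𝒢.inv (𝒢.inv x)) (𝒢.inv x) x
    (𝒢.s_inv _) (𝒢.s_inv x)
  rw [𝒢.inv_mul (𝒢.inv x), 𝒢.inv_mul x, 𝒢.s_inv x, 𝒢.unit_mul] at h
  have h2 := 𝒢.mul_unit (𝒢.inv (𝒢.inv x))
  rw [𝒢.s_inv, 𝒢.r_inv] at h2
  rw [← h2, ← h]

/-- Inversion as a homeomorphism of the space of arrows. -/
def invHomeo : G ≃ₜ G where
  toFun := 𝒢.inv
  invFun := 𝒢.inv
  left_inv := 𝒢.inv_inv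
  right_inv := 𝒢.inv_inv
  continuous_toFun := 𝒢.continuous_inv
  continuous_invFun := 𝒢.continuous_inv

theorem inv_mul_cancel {x y : G} (h : 𝒢.s x = 𝒢.r y) :
    𝒢.mul (𝒢.inv x) (𝒢.mul x y) = y := by
  rw [← 𝒢.mul_assoc _ _ _ (𝒢.s_inv x) h, 𝒢.inv_mul, h, 𝒢.unit_mul]

theorem mul_inv_cancel {x y : G} (h : 𝒢.r x = 𝒢.r y) :
    𝒢.mul x (𝒢.mul (𝒢.inv x) y) = y := by
  rw [← 𝒢.mul_assoc _ _ _ (𝒢.r_inv x).symm ((𝒢.s_inv x).trans h), 𝒢.mul_inv, h, 𝒢.unit_mul]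

theorem mul_inv_rev {x y : G} (h : 𝒢.s x = 𝒢.r y) :
    𝒢.inv (𝒢.mul x y) = 𝒢.mul (𝒢.inv y) (𝒢.inv x) := by
  have h1 : 𝒢.s (𝒢.inv y) = 𝒢.r (𝒢.inv x) := by rw [𝒢.s_inv, 𝒢.r_inv, h]
  have e : 𝒢.mul (𝒢.mul x y) (𝒢.mul (𝒢.inv y) (𝒢.inv x)) = 𝒢.unit (𝒢.r x) := by
    rw [𝒢.mul_assoc _ _ _ h (by rw [𝒢.r_mul _ _ h1, 𝒢.r_inv]),
      𝒢.mul_inv_cancel (by rw [𝒢.r_inv, h]), 𝒢.mul_inv]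
  have h2 : 𝒢.s (𝒢.mul x y) = 𝒢.r (𝒢.mul (𝒢.inv y) (𝒢.inv x)) := by
    rw [𝒢.s_mul _ _ h, 𝒢.r_mul _ _ h1, 𝒢.r_inv]
  have := 𝒢.inv_mul_cancel h2
  rw [e] at this
  rw [← this]
  have h3 := 𝒢.mul_unit (𝒢.inv (𝒢.mul x y))
  rw [𝒢.s_inv, 𝒢.r_mul _ _ h] at h3
  exact h3.symm

end TopGroupoid

/-- A left Haar system: Radon measures `meas u` on `G` with support the fibre `r ⁻¹ {u}`,
continuous in `u` when integrated against functions in `C_c(G)`, and left invariant.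
(On a second countable locally compact Hausdorff space a Borel measure that is finite on
compact sets is automatically regular.) -/
structure HaarSystem {X G : Type*} [TopologicalSpace X] [TopologicalSpace G]
    (𝒢 : TopGroupoid X G) [MeasurableSpace G] where
  meas : X → Measure G
  finite_compacts : ∀ u, IsFiniteMeasureOnCompacts (meas u)
  support_eq : ∀ u, (meas u).support = {x | 𝒢.r x = u}
  continuous_integral : ∀ f : C_c(G, ℂ), Continuous fun u => ∫ t, f t ∂(meas u)
  left_inv : ∀ (x : G) (f : C_c(G, ℂ)),
    ∫ t, f (𝒢.mul x t) ∂(meas (𝒢.s x)) = ∫ t, f t ∂(meas (𝒢.r x))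

noncomputable section

namespace HaarSystem

variable {X G : Type*} [TopologicalSpace X] [TopologicalSpace G] [MeasurableSpace G]
  {𝒢 : TopGroupoid X G} (H : HaarSystem 𝒢)

instance (u : X) : IsFiniteMeasureOnCompacts (H.meas u) := H.finite_compacts u

variable [T2Space G] [LocallyCompactSpace G] [SecondCountableTopology G] [BorelSpace G]

theorem ae_r (u : X) : ∀ᵐ t ∂(H.meas u), 𝒢.r t = u := by
  have h : (H.meas u).support ∈ ae (H.meas u) := Measure.support_mem_ae
  rw [H.support_eq] at h
  exact h

theorem continuous_param (f : C_c(G, ℂ)) (q : G × G → ℂ) (hq : Continuous q) :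
    Continuous fun x => ∫ t, f t * q (x, t) ∂(H.meas (𝒢.r x)) := by
  have hK : IsCompact (tsupport f) := f.hasCompactSupport
  obtain ⟨φ, hφ1, -, hφc, hφ01⟩ := exists_continuous_one_zero_of_isCompact hK
    (isClosed_empty (X := G)) (Set.disjoint_empty _)
  let φc : C_c(G, ℂ) := ⟨⟨fun t => (φ t : ℂ), by fun_prop⟩,
    hφc.comp_left (g := fun a : ℝ => (a : ℂ)) (by simp)⟩
  have hφint : ∀ u, ∫ t, φc t ∂(H.meas u) = ((∫ t, φ t ∂(H.meas u) : ℝ) : ℂ) := fun u =>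
    integral_ofReal
  have hφcont : Continuous fun u => ∫ t, φ t ∂(H.meas u) := by
    have := H.continuous_integral φc
    simp_rw [hφint] at this
    exact Complex.continuous_re.comp this
  have hφi : ∀ u, Integrable φ (H.meas u) := fun u =>
    φ.continuous.integrable_of_hasCompactSupport hφc
  let gc : G → C_c(G, ℂ) := fun x => ⟨⟨fun t => f t * q (x, t), by fun_prop⟩,
    f.hasCompactSupport.mul_right⟩
  rw [continuous_iff_continuousAt]
  intro x₀
  have hgc0 : Tendsto (fun x => ∫ t, gc x₀ t ∂(H.meas (𝒢.r x))) (𝓝 x₀)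
      (𝓝 (∫ t, gc x₀ t ∂(H.meas (𝒢.r x₀)))) :=
    ((H.continuous_integral (gc x₀)).comp 𝒢.continuous_r).continuousAt
  have key : Tendsto (fun x => ∫ t, gc x t ∂(H.meas (𝒢.r x)) - ∫ t, gc x₀ t ∂(H.meas (𝒢.r x)))
      (𝓝 x₀) (𝓝 0) := by
    rw [Metric.tendsto_nhds]
    intro ε hε
    set M := ∫ t, φ t ∂(H.meas (𝒢.r x₀)) + 1 with hM
    have hMpos : 0 < M := by
      have : 0 ≤ ∫ t, φ t ∂(H.meas (𝒢.r x₀)) := integral_nonneg fun t => (hφ01 t).1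
      linarith
    have h1 : ∀ᶠ x in 𝓝 x₀, ∫ t, φ t ∂(H.meas (𝒢.r x)) < M :=
      (hφcont.comp 𝒢.continuous_r).continuousAt.eventually_lt continuousAt_const
        (by simp [hM])
    have h2 : ∀ᶠ x in 𝓝 x₀, ∀ t ∈ tsupport f, ‖gc x t - gc x₀ t‖ < ε / M := by
      refine hK.eventually_forall_of_forall_eventually fun t _ => ?_
      have hc : Continuous fun z : G × G => ‖f z.2 * q (z.1, z.2) - f z.2 * q (x₀, z.2)‖ := by
        fun_prop
      exact hc.continuousAt.eventually_lt continuousAt_const (by simpa using div_pos hε hMpos)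
    filter_upwards [h1, h2] with x hx1 hx2
    have hi : ∀ y, Integrable (fun t => gc y t) (H.meas (𝒢.r x)) := fun y =>
      (gc y).continuous.integrable_of_hasCompactSupport (gc y).hasCompactSupport
    rw [dist_zero_right, ← integral_sub (hi x) (hi x₀)]
    calc ‖∫ t, (gc x t - gc x₀ t) ∂(H.meas (𝒢.r x))‖
        ≤ ∫ t, (ε / M) * φ t ∂(H.meas (𝒢.r x)) := by
          refine norm_integral_le_of_norm_le ((hφi _).const_mul _) (ae_of_all _ fun t => ?_)
          by_cases ht : t ∈ tsupport f
          · have : φ t = 1 := hφ1 ht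
            rw [this, mul_one]
            exact (hx2 t ht).le
          · have h0 : f t = 0 := image_eq_zero_of_notMem_tsupport ht
            have : gc x t - gc x₀ t = 0 := by
              change f t * q (x, t) - f t * q (x₀, t) = 0
              rw [h0]; ring
            rw [this, norm_zero]
            exact mul_nonneg (div_pos hε hMpos).le (hφ01 t).1
      _ = (ε / M) * ∫ t, φ t ∂(H.meas (𝒢.r x)) := integral_const_mul _ _
      _ < (ε / M) * M := by gcongr
      _ = ε := div_mul_cancel₀ _ hMpos.ne'
  have := key.add hgc0
  simpa [ContinuousAt, gc] using this

/-- The convolution formula `x ↦ ∫ f(t) g(t⁻¹ x) dλ^{r(x)}(t)` for arbitrary functions. -/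
def convFun (f g : G → ℂ) (x : G) : ℂ :=
  ∫ t, f t * g (𝒢.mul (𝒢.inv t) x) ∂(H.meas (𝒢.r x))

theorem continuous_convFun (f g : C_c(G, ℂ)) : Continuous (H.convFun f g) := by
  have := 𝒢.t2Space_unit
  let Z : Set (G × G) := {p | 𝒢.r p.2 = 𝒢.r p.1}
  have hZ : IsClosed Z :=
    isClosed_eq (𝒢.continuous_r.comp continuous_snd) (𝒢.continuous_r.comp continuous_fst)
  have hc : ContinuousOn (fun p : G × G => g (𝒢.mul (𝒢.inv p.2) p.1)) Z := by
    refine g.continuous.comp_continuousOn ?_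
    refine 𝒢.continuousOn_mul.comp (f := fun p : G × G => (𝒢.inv p.2, p.1)) (s := Z) ?_ ?_
    · exact ((𝒢.continuous_inv.comp continuous_snd).prodMk continuous_fst).continuousOn
    · intro p hp
      change 𝒢.s (𝒢.inv p.2) = 𝒢.r p.1
      rw [𝒢.s_inv]; exact hp
  obtain ⟨q, hq⟩ := ContinuousMap.exists_restrict_eq (Y := ℂ) hZ ⟨_, hc.domRestrict⟩
  have := H.continuous_param f q q.continuous
  convert this using 2 with x
  refine integral_congr_ae ?_
  filter_upwards [H.ae_r (𝒢.r x)] with t ht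
  have := DFunLike.congr_fun hq ⟨(x, t), ht⟩
  simp only [ContinuousMap.restrict_apply, ContinuousMap.coe_mk, Set.domRestrict_apply] at this
  rw [this]

theorem hasCompactSupport_convFun (f g : C_c(G, ℂ)) : HasCompactSupport (H.convFun f g) := by
  have := 𝒢.t2Space_unit
  let Z : Set (G × G) := {p | 𝒢.s p.1 = 𝒢.r p.2}
  have hZ : IsClosed Z :=
    isClosed_eq (𝒢.continuous_s.comp continuous_fst) (𝒢.continuous_r.comp continuous_snd)
  have hK : IsCompact ((tsupport f ×ˢ tsupport g) ∩ Z) :=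
    (f.hasCompactSupport.isCompact.prod g.hasCompactSupport.isCompact).inter_right hZ
  refine HasCompactSupport.intro
    (hK.image_of_continuousOn (𝒢.continuousOn_mul.mono Set.inter_subset_right)) ?_
  intro x hx
  refine integral_eq_zero_of_ae ?_
  filter_upwards [H.ae_r (𝒢.r x)] with t ht
  by_contra hne
  simp only [Pi.zero_apply, mul_eq_zero, not_or] at hne
  refine hx ⟨(t, 𝒢.mul (𝒢.inv t) x), ⟨⟨subset_tsupport _ hne.1, subset_tsupport _ hne.2⟩, ?_⟩,
    𝒢.mul_inv_cancel ht⟩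
  change 𝒢.s t = 𝒢.r (𝒢.mul (𝒢.inv t) x)
  rw [𝒢.r_mul _ _ ((𝒢.s_inv t).trans ht), 𝒢.r_inv]

/-- The convolution product `f * g (x) = ∫ f(t) g(t⁻¹ x) dλ^{r(x)}(t)` on `C_c(G)`. -/
def convolve (f g : C_c(G, ℂ)) : C_c(G, ℂ) where
  toFun x := ∫ t, f t * g (𝒢.mul (𝒢.inv t) x) ∂(H.meas (𝒢.r x))
  continuous_toFun := H.continuous_convFun f g
  hasCompactSupport' := H.hasCompactSupport_convFun f g

end HaarSystem
end


section Schur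
variable {α : Type*} [MeasurableSpace α] {μ : Measure α} [SFinite μ]

theorem schur_lintegral {k : α → α → ℝ≥0∞} {g : α → ℝ≥0∞} {C : ℝ≥0∞}
    (hk : AEMeasurable (Function.uncurry k) (μ.prod μ)) (hg : AEMeasurable g μ)
    (h₁ : ∀ᵐ x ∂μ, ∫⁻ y, k x y ∂μ ≤ C) (h₂ : ∀ᵐ y ∂μ, ∫⁻ x, k x y ∂μ ≤ C) :
    ∫⁻ x, (∫⁻ y, k x y * g y ∂μ) ^ 2 ∂μ ≤ C ^ 2 * ∫⁻ y, g y ^ 2 ∂μ := by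
  have hkx : ∀ᵐ x ∂μ, AEMeasurable (k x) μ := by
    obtain ⟨k', hk', he⟩ := hk
    filter_upwards [Measure.ae_ae_of_ae_prod he] with x hx
    exact ⟨fun y => k' (x, y), hk'.comp measurable_prodMk_left, hx⟩
  have hpt : ∀ᵐ x ∂μ, (∫⁻ y, k x y * g y ∂μ) ^ 2 ≤ C * ∫⁻ y, k x y * g y ^ 2 ∂μ := by
    filter_upwards [hkx, h₁] with x hx hC
    have hs : AEMeasurable (fun y => k x y ^ (1 / 2 : ℝ)) μ := hx.pow_const _
    have := ENNReal.lintegral_mul_le_Lp_mul_Lq μ Real.HolderConjugate.two_two hs (hs.mul hg)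
    have hsq : ∀ a : ℝ≥0∞, (a ^ (1 / 2 : ℝ)) ^ (2 : ℝ) = a := fun a => by
      rw [← ENNReal.rpow_mul]; norm_num
    have hsq2 : ∀ a : ℝ≥0∞, a ^ (1 / 2 : ℝ) * a ^ (1 / 2 : ℝ) = a := fun a => by
      rw [← ENNReal.rpow_add_of_nonneg _ _ (by norm_num) (by norm_num)]; norm_num
    simp only [Pi.mul_apply, ENNReal.mul_rpow_of_nonneg _ _ (zero_le_two : (0 : ℝ) ≤ 2), hsq,
      ← mul_assoc, hsq2] at this
    calc (∫⁻ y, k x y * g y ∂μ) ^ 2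
        ≤ ((∫⁻ y, k x y ∂μ) ^ (1 / 2 : ℝ) * (∫⁻ y, k x y * g y ^ (2 : ℝ) ∂μ) ^ (1 / 2 : ℝ)) ^ 2 := by
          gcongr
      _ = (∫⁻ y, k x y ∂μ) * ∫⁻ y, k x y * g y ^ 2 ∂μ := by
          rw [mul_pow, sq, sq, hsq2, hsq2]; simp
      _ ≤ _ := by gcongr
  have hkg : AEMeasurable (Function.uncurry fun x y => k x y * g y ^ 2) (μ.prod μ) :=
    hk.mul ((hg.pow_const 2).comp_snd)
  calc ∫⁻ x, (∫⁻ y, k x y * g y ∂μ) ^ 2 ∂μ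
      ≤ ∫⁻ x, C * ∫⁻ y, k x y * g y ^ 2 ∂μ ∂μ := lintegral_mono_ae hpt
    _ = C * ∫⁻ x, ∫⁻ y, k x y * g y ^ 2 ∂μ ∂μ := 
        lintegral_const_mul'' _ hkg.lintegral_prod_right'
    _ = C * ∫⁻ y, (∫⁻ x, k x y ∂μ) * g y ^ 2 ∂μ := by
        rw [lintegral_lintegral_swap hkg]
        congr 1
        refine lintegral_congr_ae ?_
        have hky : ∀ᵐ y ∂μ, AEMeasurable (fun x => k x y) μ := by
          obtain ⟨k', hk', he⟩ := hk.prod_swap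
          filter_upwards [Measure.ae_ae_of_ae_prod he] with y hy
          exact ⟨fun x => k' (y, x), hk'.comp measurable_prodMk_left, hy⟩
        filter_upwards [hky] with y hy
        exact lintegral_mul_const'' _ hy
    _ ≤ C * ∫⁻ y, C * g y ^ 2 ∂μ := by
        gcongr 1
        refine lintegral_mono_ae ?_
        filter_upwards [h₂] with y hy
        gcongr
    _ = C ^ 2 * ∫⁻ y, g y ^ 2 ∂μ := by
        rw [lintegral_const_mul'' _ (hg.pow_const 2), sq, mul_assoc]

theorem eLpNorm_two_sq {f : α → ℂ} : eLpNorm f 2 μ ^ 2 = ∫⁻ x, ‖f x‖ₑ ^ 2 ∂μ := by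
  rw [eLpNorm_eq_lintegral_rpow_enorm_toReal (by norm_num) (by norm_num)]
  simp only [ENNReal.toReal_ofNat, ENNReal.rpow_ofNat]
  rw [← ENNReal.rpow_natCast, ← ENNReal.rpow_mul]; norm_num

theorem schur_memLp {k : α → α → ℂ} {ξ : α → ℂ} {C : ℝ≥0}
    (hk : AEStronglyMeasurable (Function.uncurry k) (μ.prod μ)) (hξ : MemLp ξ 2 μ)
    (h₁ : ∀ᵐ x ∂μ, ∫⁻ y, ‖k x y‖ₑ ∂μ ≤ C) (h₂ : ∀ᵐ y ∂μ, ∫⁻ x, ‖k x y‖ₑ ∂μ ≤ C) :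
    MemLp (fun x => ∫ y, k x y * ξ y ∂μ) 2 μ ∧
      eLpNorm (fun x => ∫ y, k x y * ξ y ∂μ) 2 μ ≤ C * eLpNorm ξ 2 μ := by
  have hb := schur_lintegral (k := fun x y => ‖k x y‖ₑ) (g := fun y => ‖ξ y‖ₑ) (C := C)
    hk.enorm hξ.1.enorm h₁ h₂
  have hle : eLpNorm (fun x => ∫ y, k x y * ξ y ∂μ) 2 μ ≤ C * eLpNorm ξ 2 μ := by
    rw [← ENNReal.pow_le_pow_left_iff two_ne_zero, mul_pow, eLpNorm_two_sq, eLpNorm_two_sq]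
    refine le_trans (lintegral_mono fun x => ?_) hb
    gcongr
    refine (enorm_integral_le_lintegral_enorm _).trans (le_of_eq ?_)
    simp_rw [enorm_mul]
  refine ⟨⟨?_, hle.trans_lt (ENNReal.mul_lt_top ENNReal.coe_lt_top hξ.2)⟩, hle⟩
  have : AEStronglyMeasurable (Function.uncurry fun x y => k x y * ξ y) (μ.prod μ) :=
    hk.mul hξ.1.comp_snd
  exact this.integral_prod_right'

theorem schur_integrable {k : α → α → ℂ} {ξ η : α → ℂ} {C : ℝ≥0}
    (hk : AEStronglyMeasurable (Function.uncurry k) (μ.prod μ)) (hξ : MemLp ξ 2 μ)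
    (hη : MemLp η 2 μ)
    (h₁ : ∀ᵐ x ∂μ, ∫⁻ y, ‖k x y‖ₑ ∂μ ≤ C) (h₂ : ∀ᵐ y ∂μ, ∫⁻ x, ‖k x y‖ₑ ∂μ ≤ C) :
    Integrable (Function.uncurry fun x y => η x * (k x y * ξ y)) (μ.prod μ) := by
  have hm : AEStronglyMeasurable (Function.uncurry fun x y => η x * (k x y * ξ y)) (μ.prod μ) :=
    hη.1.comp_fst.mul (hk.mul hξ.1.comp_snd)
  refine ⟨hm, ?_⟩
  have hb := schur_lintegral (k := fun x y => ‖k x y‖ₑ) (g := fun y => ‖ξ y‖ₑ) (C := C)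
    hk.enorm hξ.1.enorm h₁ h₂
  have hkξ : AEMeasurable (Function.uncurry fun x y => ‖k x y‖ₑ * ‖ξ y‖ₑ) (μ.prod μ) :=
    hk.enorm.mul hξ.1.enorm.comp_snd
  rw [hasFiniteIntegral_iff_enorm, lintegral_prod _ hm.enorm]
  calc ∫⁻ x, ∫⁻ y, ‖Function.uncurry (fun x y => η x * (k x y * ξ y)) (x, y)‖ₑ ∂μ ∂μ
      = ∫⁻ x, ‖η x‖ₑ * ∫⁻ y, ‖k x y‖ₑ * ‖ξ y‖ₑ ∂μ ∂μ := by
        refine lintegral_congr fun x => ?_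
        simp only [Function.uncurry_apply_pair, enorm_mul]
        exact lintegral_const_mul' _ _ enorm_ne_top
    _ ≤ (∫⁻ x, ‖η x‖ₑ ^ (2 : ℝ) ∂μ) ^ (1 / 2 : ℝ) *
          (∫⁻ x, (∫⁻ y, ‖k x y‖ₑ * ‖ξ y‖ₑ ∂μ) ^ (2 : ℝ) ∂μ) ^ (1 / 2 : ℝ) :=
        ENNReal.lintegral_mul_le_Lp_mul_Lq μ Real.HolderConjugate.two_two hη.1.enorm
          hkξ.lintegral_prod_right'
    _ < ⊤ := by
        simp only [ENNReal.rpow_ofNat]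
        rw [← eLpNorm_two_sq (f := η)]
        refine ENNReal.mul_lt_top (ENNReal.rpow_lt_top_of_nonneg (by norm_num)
          (ENNReal.pow_ne_top hη.2.ne)) (ENNReal.rpow_lt_top_of_nonneg (by norm_num)
          (ne_top_of_le_ne_top ?_ hb))
        rw [← eLpNorm_two_sq (f := ξ)]
        exact ENNReal.mul_ne_top (ENNReal.pow_ne_top ENNReal.coe_ne_top)
          (ENNReal.pow_ne_top hξ.2.ne)
end Schur

noncomputable section
namespace HaarSystem

variable {X G : Type*} [TopologicalSpace X] [TopologicalSpace G] [MeasurableSpace G]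
  {𝒢 : TopGroupoid X G} (H : HaarSystem 𝒢)
  [T2Space G] [LocallyCompactSpace G] [SecondCountableTopology G] [BorelSpace G]

/-- The measure `λ_u`, the image of `λ^u` under inversion; it lives on `s ⁻¹ {u}`. -/
def measS (u : X) : Measure G := (H.meas u).map 𝒢.inv

instance (u : X) : SFinite (H.measS u) := by unfold measS; infer_instance

theorem ae_s (u : X) : ∀ᵐ x ∂(H.measS u), 𝒢.s x = u := by
  unfold measS
  have hm : Measurable 𝒢.inv := 𝒢.continuous_inv.measurable
  have hX := 𝒢.t2Space_unit
  rw [ae_map_iff hm.aemeasurable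
    (isClosed_eq 𝒢.continuous_s continuous_const).measurableSet]
  filter_upwards [H.ae_r u] with t ht
  rw [𝒢.s_inv, ht]

theorem continuousOn_mul_left (x : G) :
    ContinuousOn (fun t => 𝒢.mul x t) {t | 𝒢.r t = 𝒢.s x} :=
  𝒢.continuousOn_mul.comp (f := fun t => (x, t)) (by fun_prop) fun _ ht => Eq.symm ht

theorem isClosed_fiber (u : X) : IsClosed {t | 𝒢.r t = u} := by
  have hX := 𝒢.t2Space_unit
  exact isClosed_eq 𝒢.continuous_r continuous_const

theorem aemeasurable_mul_left (x : G) : AEMeasurable (fun t => 𝒢.mul x t) (H.meas (𝒢.s x)) := by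
  have h := (continuousOn_mul_left (𝒢 := 𝒢) x).aemeasurable (μ := H.meas (𝒢.s x))
    (isClosed_fiber (𝒢 := 𝒢) (𝒢.s x)).measurableSet
  rwa [Measure.restrict_eq_self_of_ae_mem (s := {t | 𝒢.r t = _}) (H.ae_r _)] at h

theorem map_mul_left (x : G) :
    (H.meas (𝒢.s x)).map (fun t => 𝒢.mul x t) = H.meas (𝒢.r x) := by
  have hm := H.aemeasurable_mul_left x
  have hfin : IsFiniteMeasureOnCompacts ((H.meas (𝒢.s x)).map (fun t => 𝒢.mul x t)) := by
    refine ⟨fun K hK => ?_⟩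
    rw [Measure.map_apply_of_aemeasurable hm hK.measurableSet]
    have hc : IsCompact ((fun t => 𝒢.mul (𝒢.inv x) t) '' (K ∩ {t | 𝒢.r t = 𝒢.s (𝒢.inv x)})) :=
      (hK.inter_right (isClosed_fiber (𝒢 := 𝒢) _)).image_of_continuousOn
        ((continuousOn_mul_left (𝒢 := 𝒢) (𝒢.inv x)).mono Set.inter_subset_right)
    refine lt_of_le_of_lt (measure_mono_ae ?_) (hc.measure_lt_top (μ := H.meas (𝒢.s x)))
    filter_upwards [H.ae_r (𝒢.s x)] with t ht htK
    exact ⟨𝒢.mul x t, ⟨htK, by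
      change 𝒢.r _ = _
      rw [𝒢.r_mul _ _ ht.symm, 𝒢.s_inv]⟩, 𝒢.inv_mul_cancel ht.symm⟩
  refine Measure.ext_of_integral_eq_on_compactlySupported fun f => ?_
  rw [integral_map hm (map_continuous f).aestronglyMeasurable]
  let fc : C_c(G, ℂ) := ⟨⟨fun t => (f t : ℂ), by fun_prop⟩,
    f.hasCompactSupport.comp_left (g := fun a : ℝ => (a : ℂ)) (by simp)⟩
  have h := H.left_inv x fc
  have h1 : ∫ t, fc (𝒢.mul x t) ∂(H.meas (𝒢.s x)) =
      ((∫ t, f (𝒢.mul x t) ∂(H.meas (𝒢.s x)) : ℝ) : ℂ) := integral_ofReal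
  have h2 : ∫ t, fc t ∂(H.meas (𝒢.r x)) = ((∫ t, f t ∂(H.meas (𝒢.r x)) : ℝ) : ℂ) :=
    integral_ofReal
  rw [h1, h2] at h
  exact_mod_cast h

theorem inv_measS (u : X) : (H.measS u).map 𝒢.inv = H.meas u := by
  have hm : Measurable 𝒢.inv := 𝒢.continuous_inv.measurable
  rw [measS, Measure.map_map hm hm]
  have : 𝒢.inv ∘ 𝒢.inv = id := funext 𝒢.inv_inv
  rw [this, Measure.map_id]

theorem aemeasurable_mul_inv (x : G) :
    AEMeasurable (fun y => 𝒢.mul x (𝒢.inv y)) (H.measS (𝒢.s x)) := by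
  have h := H.aemeasurable_mul_left x
  rw [← H.inv_measS] at h
  exact h.comp_aemeasurable 𝒢.continuous_inv.measurable.aemeasurable

theorem map_mul_inv (x : G) :
    (H.measS (𝒢.s x)).map (fun y => 𝒢.mul x (𝒢.inv y)) = H.meas (𝒢.r x) := by
  have h := H.aemeasurable_mul_left x
  rw [← H.map_mul_left x, ← H.inv_measS, AEMeasurable.map_map_of_aemeasurable]
  · rfl
  · rwa [H.inv_measS]
  · exact 𝒢.continuous_inv.measurable.aemeasurable

theorem mul_inv_inv_mul {x y : G} (h : 𝒢.s y = 𝒢.s x) :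
    𝒢.mul (𝒢.inv (𝒢.mul x (𝒢.inv y))) x = y := by
  have h1 : 𝒢.s x = 𝒢.r (𝒢.inv y) := by rw [𝒢.r_inv, h]
  rw [𝒢.mul_inv_rev h1, 𝒢.inv_inv, 𝒢.mul_assoc _ _ _ (by rw [𝒢.r_inv, h]) (𝒢.s_inv x),
    𝒢.inv_mul, ← h, 𝒢.mul_unit]

theorem continuousOn_inv_mul (x : G) :
    ContinuousOn (fun t => 𝒢.mul (𝒢.inv t) x) {t | 𝒢.r t = 𝒢.r x} :=
  𝒢.continuousOn_mul.comp (f := fun t => (𝒢.inv t, x))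
    (𝒢.continuous_inv.prodMk continuous_const).continuousOn
    fun t ht => (𝒢.s_inv t).trans ht

theorem aemeasurable_inv_mul (x : G) :
    AEMeasurable (fun t => 𝒢.mul (𝒢.inv t) x) (H.meas (𝒢.r x)) := by
  have h := (continuousOn_inv_mul (𝒢 := 𝒢) x).aemeasurable (μ := H.meas (𝒢.r x))
    (isClosed_fiber (𝒢 := 𝒢) (𝒢.r x)).measurableSet
  rwa [Measure.restrict_eq_self_of_ae_mem (s := {t | 𝒢.r t = _}) (H.ae_r _)] at h

theorem map_inv_mul (x : G) :
    (H.meas (𝒢.r x)).map (fun t => 𝒢.mul (𝒢.inv t) x) = H.measS (𝒢.s x) := by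
  have h := H.aemeasurable_inv_mul x
  rw [← H.map_mul_inv] at h ⊢
  rw [AEMeasurable.map_map_of_aemeasurable h (H.aemeasurable_mul_inv x)]
  have : (fun t => 𝒢.mul (𝒢.inv t) x) ∘ (fun y => 𝒢.mul x (𝒢.inv y))
      =ᵐ[H.measS (𝒢.s x)] id := by
    filter_upwards [H.ae_s (𝒢.s x)] with y hy
    exact mul_inv_inv_mul hy
  rw [Measure.map_congr this, Measure.map_id]

theorem conv_eq_integral_measS (F : C_c(G, ℂ)) {ξ : G → ℂ} {x : G}
    (hξ : AEStronglyMeasurable ξ (H.measS (𝒢.s x))) :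
    ∫ t, F t * ξ (𝒢.mul (𝒢.inv t) x) ∂(H.meas (𝒢.r x)) =
      ∫ y, F (𝒢.mul x (𝒢.inv y)) * ξ y ∂(H.measS (𝒢.s x)) := by
  have h1 : AEStronglyMeasurable (fun t => ξ (𝒢.mul (𝒢.inv t) x)) (H.meas (𝒢.r x)) := by
    rw [← H.map_inv_mul] at hξ
    exact hξ.comp_aemeasurable (H.aemeasurable_inv_mul x)
  have h2 : AEStronglyMeasurable (fun t => F t * ξ (𝒢.mul (𝒢.inv t) x)) (H.meas (𝒢.r x)) :=
    F.continuous.aestronglyMeasurable.mul h1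
  rw [← H.map_mul_inv] at h2 ⊢
  rw [integral_map (H.aemeasurable_mul_inv x) h2]
  refine integral_congr_ae ?_
  filter_upwards [H.ae_s (𝒢.s x)] with y hy
  rw [mul_inv_inv_mul hy]

/-- `F^∨(x) = F(x⁻¹)`. -/
def check (F : C_c(G, ℂ)) : C_c(G, ℂ) where
  toFun x := F (𝒢.inv x)
  continuous_toFun := F.continuous.comp 𝒢.continuous_inv
  hasCompactSupport' := F.hasCompactSupport.comp_homeomorph 𝒢.invHomeo

/-- The involution `F^*(x) = conj (F(x⁻¹))` of `C_c(G)`. -/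
def invol (F : C_c(G, ℂ)) : C_c(G, ℂ) where
  toFun x := starRingEnd ℂ (F (𝒢.inv x))
  continuous_toFun := Complex.continuous_conj.comp (F.continuous.comp 𝒢.continuous_inv)
  hasCompactSupport' :=
    (F.hasCompactSupport.comp_homeomorph 𝒢.invHomeo).comp_left (map_zero _)

theorem exists_bound (F : C_c(G, ℂ)) : ∃ C : ℝ≥0, ∀ u, ∫⁻ t, ‖F t‖ₑ ∂(H.meas u) ≤ C := by
  let Fa : C_c(G, ℂ) := ⟨⟨fun t => (‖F t‖ : ℂ), by fun_prop⟩,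
    F.hasCompactSupport.comp_left (g := fun a : ℂ => (‖a‖ : ℂ)) (by simp)⟩
  have h1 : ∀ u, ∫ t, Fa t ∂(H.meas u) = ((∫ t, ‖F t‖ ∂(H.meas u) : ℝ) : ℂ) := fun u =>
    integral_ofReal
  have hc : Continuous fun u => ∫ t, ‖F t‖ ∂(H.meas u) := by
    have := H.continuous_integral Fa
    simp_rw [h1] at this
    exact Complex.continuous_re.comp this
  have hK : IsCompact (𝒢.r '' tsupport F) := F.hasCompactSupport.isCompact.image 𝒢.continuous_r
  obtain ⟨C, hC⟩ := (hK.image hc).isBounded.bddAbove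
  refine ⟨C.toNNReal, fun u => ?_⟩
  rw [← ofReal_integral_norm_eq_lintegral_enorm
    ((map_continuous F).integrable_of_hasCompactSupport F.hasCompactSupport)]
  by_cases hu : u ∈ 𝒢.r '' tsupport F
  · exact ENNReal.ofReal_le_ofReal (hC ⟨u, hu, rfl⟩)
  · have : ∫ t, ‖F t‖ ∂(H.meas u) = 0 := by
      refine integral_eq_zero_of_ae ?_
      filter_upwards [H.ae_r u] with t ht
      have : t ∉ tsupport F := fun h => hu ⟨t, h, ht⟩
      simp [image_eq_zero_of_notMem_tsupport this]
    simp [this]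

end HaarSystem
end

noncomputable section
section OpProd
variable {ι : Type*} (K : ι → Type*) [∀ i, NormedAddCommGroup (K i)]
  [∀ i, InnerProductSpace ℂ (K i)] [∀ i, CompleteSpace (K i)]

/-- The C*-algebra of bounded families of operators on a family of Hilbert spaces, with the
supremum norm. -/
abbrev OpProd : Type _ := lp (fun i => K i →L[ℂ] K i) ∞

instance : NonUnitalCStarAlgebra (OpProd K) where

variable {K}

/-- The norm closure of the image of a linear map whose image is a *-subalgebra. -/
def starClosure {V : Type*} [AddCommGroup V] [Module ℂ V] (π : V →ₗ[ℂ] OpProd K)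
    (hmul : ∀ v w, π v * π w ∈ Set.range π) (hstar : ∀ v, star (π v) ∈ Set.range π) :
    NonUnitalStarSubalgebra ℂ (OpProd K) :=
  NonUnitalStarSubalgebra.topologicalClosure
    { LinearMap.range π with
      mul_mem' := by rintro _ _ ⟨v, rfl⟩ ⟨w, rfl⟩; exact hmul v w
      star_mem' := by rintro _ ⟨v, rfl⟩; exact hstar v }


@[reducible] def starClosureCStar {V : Type*} [AddCommGroup V] [Module ℂ V] (π : V →ₗ[ℂ] OpProd K)
    (hmul : ∀ v w, π v * π w ∈ Set.range π) (hstar : ∀ v, star (π v) ∈ Set.range π) :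
    NonUnitalCStarAlgebra (starClosure π hmul hstar) :=
  NonUnitalStarSubalgebra.nonUnitalCStarAlgebra _ (h_closed := isClosed_closure)
end OpProd
end
noncomputable section
namespace HaarSystem

variable {X G : Type*} [TopologicalSpace X] [TopologicalSpace G] [MeasurableSpace G]
  {𝒢 : TopGroupoid X G} (H : HaarSystem 𝒢)
  [T2Space G] [LocallyCompactSpace G] [SecondCountableTopology G] [BorelSpace G]

theorem lintegral_kernel (F : C_c(G, ℂ)) (x : G) :
    ∫⁻ y, ‖F (𝒢.mul x (𝒢.inv y))‖ₑ ∂(H.measS (𝒢.s x)) = ∫⁻ t, ‖F t‖ₑ ∂(H.meas (𝒢.r x)) := by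
  rw [← H.map_mul_inv, lintegral_map' (map_continuous F).enorm.aemeasurable
    (H.aemeasurable_mul_inv x)]

theorem aestronglyMeasurable_kernel (F : C_c(G, ℂ)) (u : X) :
    AEStronglyMeasurable (Function.uncurry fun x y => F (𝒢.mul x (𝒢.inv y)))
      ((H.measS u).prod (H.measS u)) := by
  have hX := 𝒢.t2Space_unit
  let Z : Set (G × G) := {p | 𝒢.s p.1 = 𝒢.s p.2}
  have hZ : IsClosed Z :=
    isClosed_eq (𝒢.continuous_s.comp continuous_fst) (𝒢.continuous_s.comp continuous_snd)
  have hc : ContinuousOn (Function.uncurry fun x y => F (𝒢.mul x (𝒢.inv y))) Z := by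
    refine (map_continuous F).comp_continuousOn ?_
    refine 𝒢.continuousOn_mul.comp (f := fun p : G × G => (p.1, 𝒢.inv p.2)) (s := Z) ?_ ?_
    · exact (continuous_fst.prodMk (𝒢.continuous_inv.comp continuous_snd)).continuousOn
    · intro p hp
      change 𝒢.s p.1 = 𝒢.r (𝒢.inv p.2)
      rw [𝒢.r_inv]; exact hp
  have h := hc.aestronglyMeasurable (μ := (H.measS u).prod (H.measS u)) hZ.measurableSet
  rwa [Measure.restrict_eq_self_of_ae_mem] at h
  have h1 := H.ae_s u
  filter_upwards [Measure.quasiMeasurePreserving_fst.ae h1,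
    Measure.quasiMeasurePreserving_snd.ae h1] with p hp1 hp2
  exact hp1.trans hp2.symm

theorem exists_kernel_bound (F : C_c(G, ℂ)) : ∃ C : ℝ≥0, ∀ u,
    (∀ᵐ x ∂(H.measS u), ∫⁻ y, ‖F (𝒢.mul x (𝒢.inv y))‖ₑ ∂(H.measS u) ≤ C) ∧
    (∀ᵐ y ∂(H.measS u), ∫⁻ x, ‖F (𝒢.mul x (𝒢.inv y))‖ₑ ∂(H.measS u) ≤ C) := by
  obtain ⟨C₁, h₁⟩ := H.exists_bound F
  obtain ⟨C₂, h₂⟩ := H.exists_bound (check (𝒢 := 𝒢) F)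
  refine ⟨max C₁ C₂, fun u => ⟨?_, ?_⟩⟩
  · filter_upwards [H.ae_s u] with x hx
    subst hx
    rw [H.lintegral_kernel]
    exact (h₁ _).trans (by simp)
  · filter_upwards [H.ae_s u] with y hy
    subst hy
    have : ∫⁻ x, ‖F (𝒢.mul x (𝒢.inv y))‖ₑ ∂(H.measS (𝒢.s y)) =
        ∫⁻ x, ‖check (𝒢 := 𝒢) F (𝒢.mul y (𝒢.inv x))‖ₑ ∂(H.measS (𝒢.s y)) := by
      refine lintegral_congr_ae ?_
      filter_upwards [H.ae_s (𝒢.s y)] with x hx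
      change _ = ‖F (𝒢.inv (𝒢.mul y (𝒢.inv x)))‖ₑ
      rw [𝒢.mul_inv_rev (by rw [𝒢.r_inv, hx]), 𝒢.inv_inv]
    rw [this, H.lintegral_kernel]
    exact (h₂ _).trans (by simp)

theorem regFun_ae (F : C_c(G, ℂ)) (u : X) {ξ : G → ℂ}
    (hξ : AEStronglyMeasurable ξ (H.measS u)) :
    H.convFun F ξ =ᵐ[H.measS u] fun x => ∫ y, F (𝒢.mul x (𝒢.inv y)) * ξ y ∂(H.measS u) := by
  filter_upwards [H.ae_s u] with x hx
  subst hx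
  exact H.conv_eq_integral_measS F hξ

theorem regFun_memLp (F : C_c(G, ℂ)) (u : X) {ξ : G → ℂ} (hξ : MemLp ξ 2 (H.measS u)) :
    MemLp (fun x => ∫ t, F t * ξ (𝒢.mul (𝒢.inv t) x) ∂(H.meas (𝒢.r x))) 2 (H.measS u) := by
  obtain ⟨C, hC⟩ := H.exists_kernel_bound F
  exact (schur_memLp (H.aestronglyMeasurable_kernel F u) hξ (hC u).1 (hC u).2).1.ae_eq
    (H.regFun_ae F u hξ.1).symm

theorem regFun_eLpNorm (F : C_c(G, ℂ)) : ∃ C : ℝ≥0, ∀ u, ∀ ξ : G → ℂ, MemLp ξ 2 (H.measS u) →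
    eLpNorm (H.convFun F ξ) 2 (H.measS u) ≤ C * eLpNorm ξ 2 (H.measS u) := by
  obtain ⟨C, hC⟩ := H.exists_kernel_bound F
  refine ⟨C, fun u ξ hξ => ?_⟩
  rw [eLpNorm_congr_ae (H.regFun_ae F u hξ.1)]
  exact (schur_memLp (H.aestronglyMeasurable_kernel F u) hξ (hC u).1 (hC u).2).2

theorem kernel_memLp (F : C_c(G, ℂ)) (x : G) :
    MemLp (fun y => F (𝒢.mul x (𝒢.inv y))) 2 (H.measS (𝒢.s x)) := by
  have h : MemLp F 2 (H.meas (𝒢.r x)) :=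
    (map_continuous F).memLp_of_hasCompactSupport F.hasCompactSupport
  rw [← H.map_mul_inv] at h
  exact h.comp_of_map (H.aemeasurable_mul_inv x)

theorem kernel_integrable (F : C_c(G, ℂ)) (x : G) {ξ : G → ℂ} (hξ : MemLp ξ 2 (H.measS (𝒢.s x))) :
    Integrable (fun y => F (𝒢.mul x (𝒢.inv y)) * ξ y) (H.measS (𝒢.s x)) :=
  (H.kernel_memLp F x).integrable_mul hξ

/-- The regular representation `π_u(F) ξ (x) = ∫ F(t) ξ(t⁻¹ x) dλ^{r(x)}(t)` on `L²(G_u)`. -/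
def regRep (u : X) (F : C_c(G, ℂ)) : Lp ℂ 2 (H.measS u) →L[ℂ] Lp ℂ 2 (H.measS u) :=
  LinearMap.mkContinuousOfExistsBound
    { toFun := fun ξ => (H.regFun_memLp F u (Lp.memLp ξ)).toLp
        (fun x => ∫ t, F t * ξ (𝒢.mul (𝒢.inv t) x) ∂(H.meas (𝒢.r x)))
      map_add' := fun ξ η => by
        rw [← MemLp.toLp_add]
        refine MemLp.toLp_congr _ _ ?_
        have e := H.regFun_ae F u (Lp.memLp (ξ + η)).1
        have e1 := H.regFun_ae F u (Lp.memLp ξ).1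
        have e2 := H.regFun_ae F u (Lp.memLp η).1
        filter_upwards [e, e1, e2, H.ae_s u] with x h h1 h2 hx
        refine h.trans ?_
        refine Eq.trans ?_ (congrArg₂ (· + ·) h1 h2).symm
        subst hx
        rw [← integral_add (H.kernel_integrable F x (Lp.memLp ξ))
          (H.kernel_integrable F x (Lp.memLp η))]
        refine integral_congr_ae ?_
        filter_upwards [Lp.coeFn_add ξ η] with y hy
        rw [hy, Pi.add_apply, mul_add]
      map_smul' := fun c ξ => by
        rw [RingHom.id_apply, ← MemLp.toLp_const_smul]
        refine MemLp.toLp_congr _ _ ?_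
        have e := H.regFun_ae F u (Lp.memLp (c • ξ)).1
        have e1 := H.regFun_ae F u (Lp.memLp ξ).1
        filter_upwards [e, e1] with x h h1
        refine h.trans ?_
        refine Eq.trans ?_ (congrArg (c • ·) h1).symm
        simp only [smul_eq_mul]
        rw [← integral_const_mul]
        refine integral_congr_ae ?_
        filter_upwards [Lp.coeFn_smul c ξ] with y hy
        rw [hy, Pi.smul_apply, smul_eq_mul]; ring }
    (by
      obtain ⟨C, hC⟩ := H.regFun_eLpNorm F
      refine ⟨C, fun ξ => ?_⟩
      change ‖MemLp.toLp _ (H.regFun_memLp F u (Lp.memLp ξ))‖ ≤ _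
      rw [Lp.norm_toLp, Lp.norm_def]
      have := ENNReal.toReal_mono (ENNReal.mul_ne_top ENNReal.coe_ne_top (Lp.memLp ξ).2.ne)
        (hC u ξ (Lp.memLp ξ))
      rwa [ENNReal.toReal_mul, ENNReal.coe_toReal] at this)

theorem regRep_ae (u : X) (F : C_c(G, ℂ)) (ξ : Lp ℂ 2 (H.measS u)) :
    H.regRep u F ξ =ᵐ[H.measS u] H.convFun F ξ :=
  MemLp.coeFn_toLp (H.regFun_memLp F u (Lp.memLp ξ))

theorem regRep_ae' (u : X) (F : C_c(G, ℂ)) (ξ : Lp ℂ 2 (H.measS u)) :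
    H.regRep u F ξ =ᵐ[H.measS u] fun x => ∫ y, F (𝒢.mul x (𝒢.inv y)) * ξ y ∂(H.measS u) :=
  (H.regRep_ae u F ξ).trans (H.regFun_ae F u (Lp.memLp ξ).1)

theorem exists_regRep_bound (F : C_c(G, ℂ)) : ∃ C : ℝ, ∀ u, ‖H.regRep u F‖ ≤ C := by
  obtain ⟨C, hC⟩ := H.regFun_eLpNorm F
  refine ⟨C, fun u => ContinuousLinearMap.opNorm_le_bound _ C.2 fun ξ => ?_⟩
  change ‖MemLp.toLp _ (H.regFun_memLp F u (Lp.memLp ξ))‖ ≤ _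
  rw [Lp.norm_toLp, Lp.norm_def]
  have := ENNReal.toReal_mono (ENNReal.mul_ne_top ENNReal.coe_ne_top (Lp.memLp ξ).2.ne)
    (hC u ξ (Lp.memLp ξ))
  rwa [ENNReal.toReal_mul, ENNReal.coe_toReal] at this

theorem regRep_add (u : X) (F F' : C_c(G, ℂ)) :
    H.regRep u (F + F') = H.regRep u F + H.regRep u F' := by
  ext1 ξ
  refine Lp.ext ?_
  filter_upwards [H.regRep_ae' u (F + F') ξ, H.regRep_ae' u F ξ, H.regRep_ae' u F' ξ,
    Lp.coeFn_add (H.regRep u F ξ) (H.regRep u F' ξ), H.ae_s u] with x h h1 h2 h3 hx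
  rw [h, add_apply, h3, Pi.add_apply, h1, h2]
  subst hx
  rw [← integral_add (H.kernel_integrable F x (Lp.memLp ξ))
          (H.kernel_integrable F' x (Lp.memLp ξ))]
  simp [add_mul]

theorem regRep_smul (u : X) (c : ℂ) (F : C_c(G, ℂ)) :
    H.regRep u (c • F) = c • H.regRep u F := by
  ext1 ξ
  refine Lp.ext ?_
  filter_upwards [H.regRep_ae' u (c • F) ξ, H.regRep_ae' u F ξ,
    Lp.coeFn_smul c (H.regRep u F ξ)] with x h h1 h3
  rw [h, smul_apply, h3, Pi.smul_apply, h1, smul_eq_mul,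
    ← integral_const_mul]
  simp [mul_assoc]

theorem conv_kernel (F F' : C_c(G, ℂ)) {x y : G} (h : 𝒢.s x = 𝒢.s y) :
    H.convolve F F' (𝒢.mul x (𝒢.inv y)) =
      ∫ z, F (𝒢.mul x (𝒢.inv z)) * F' (𝒢.mul z (𝒢.inv y)) ∂(H.measS (𝒢.s x)) := by
  have hxy : 𝒢.s x = 𝒢.r (𝒢.inv y) := by rw [𝒢.r_inv, h]
  have hr : 𝒢.r (𝒢.mul x (𝒢.inv y)) = 𝒢.r x := 𝒢.r_mul _ _ hxy
  have hm : AEStronglyMeasurable (fun z => F' (𝒢.mul z (𝒢.inv y))) (H.measS (𝒢.s x)) := by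
    have hc : ContinuousOn (fun z => F' (𝒢.mul z (𝒢.inv y))) {z | 𝒢.s z = 𝒢.s x} := by
      refine (map_continuous F').comp_continuousOn ?_
      exact 𝒢.continuousOn_mul.comp (f := fun z => (z, 𝒢.inv y)) (by fun_prop)
        fun z hz => (Eq.trans hz hxy :)
    have hX := 𝒢.t2Space_unit
    have h' := hc.aestronglyMeasurable (μ := H.measS (𝒢.s x))
      (isClosed_eq 𝒢.continuous_s continuous_const).measurableSet
    rwa [Measure.restrict_eq_self_of_ae_mem (s := {z | 𝒢.s z = 𝒢.s x}) (H.ae_s _)] at h'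
  have := H.conv_eq_integral_measS F hm
  rw [← this]
  change ∫ t, F t * F' (𝒢.mul (𝒢.inv t) (𝒢.mul x (𝒢.inv y))) ∂(H.meas _) = _
  rw [hr]
  refine integral_congr_ae ?_
  filter_upwards [H.ae_r (𝒢.r x)] with t ht
  rw [𝒢.mul_assoc _ _ _ ((𝒢.s_inv t).trans ht) hxy]

theorem regRep_conv (u : X) (F F' : C_c(G, ℂ)) :
    H.regRep u (H.convolve F F') = H.regRep u F * H.regRep u F' := by
  ext1 ξ
  refine Lp.ext ?_
  filter_upwards [H.regRep_ae' u (H.convolve F F') ξ, H.regRep_ae' u F (H.regRep u F' ξ),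
    H.ae_s u] with x h h1 hx
  refine h.trans (Eq.trans ?_ h1.symm)
  subst hx
  obtain ⟨C, hC⟩ := H.exists_kernel_bound F'
  have hint := schur_integrable (H.aestronglyMeasurable_kernel F' (𝒢.s x)) (Lp.memLp ξ)
    (H.kernel_memLp F x) (hC _).1 (hC _).2
  calc ∫ y, H.convolve F F' (𝒢.mul x (𝒢.inv y)) * ξ y ∂(H.measS (𝒢.s x))
      = ∫ y, ∫ z, F (𝒢.mul x (𝒢.inv z)) * (F' (𝒢.mul z (𝒢.inv y)) * ξ y) ∂(H.measS (𝒢.s x))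
          ∂(H.measS (𝒢.s x)) := by
        refine integral_congr_ae ?_
        filter_upwards [H.ae_s (𝒢.s x)] with y hy
        rw [H.conv_kernel F F' hy.symm, ← integral_mul_const]
        simp only [mul_assoc]
    _ = ∫ z, ∫ y, F (𝒢.mul x (𝒢.inv z)) * (F' (𝒢.mul z (𝒢.inv y)) * ξ y) ∂(H.measS (𝒢.s x))
          ∂(H.measS (𝒢.s x)) := (integral_integral_swap hint).symm
    _ = _ := by
        refine integral_congr_ae ?_
        filter_upwards [H.regRep_ae' (𝒢.s x) F' ξ] with z hz
        rw [hz, integral_const_mul]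

theorem regRep_invol (u : X) (F : C_c(G, ℂ)) :
    H.regRep u (invol (𝒢 := 𝒢) F) = star (H.regRep u F) := by
  rw [ContinuousLinearMap.star_eq_adjoint, ContinuousLinearMap.eq_adjoint_iff]
  intro η ξ
  rw [L2.inner_def, L2.inner_def]
  obtain ⟨C, hC⟩ := H.exists_kernel_bound F
  have hη : MemLp (fun x => starRingEnd ℂ (η x)) 2 (H.measS u) := (Lp.memLp η).star
  have hint := schur_integrable (H.aestronglyMeasurable_kernel F u) (Lp.memLp ξ) hη (hC u).1 (hC u).2
  calc ∫ y, inner ℂ (H.regRep u (invol (𝒢 := 𝒢) F) η y) (ξ y) ∂(H.measS u)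
      = ∫ y, ∫ x, starRingEnd ℂ (η x) * (F (𝒢.mul x (𝒢.inv y)) * ξ y) ∂(H.measS u)
          ∂(H.measS u) := by
        refine integral_congr_ae ?_
        filter_upwards [H.regRep_ae' u (invol (𝒢 := 𝒢) F) η, H.ae_s u] with y hy hsy
        rw [hy, RCLike.inner_apply, ← integral_conj, ← integral_const_mul]
        refine integral_congr_ae ?_
        filter_upwards [H.ae_s u] with x hx
        have : invol (𝒢 := 𝒢) F (𝒢.mul y (𝒢.inv x)) =
            starRingEnd ℂ (F (𝒢.mul x (𝒢.inv y))) := by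
          change starRingEnd ℂ (F (𝒢.inv (𝒢.mul y (𝒢.inv x)))) = _
          rw [𝒢.mul_inv_rev (by rw [𝒢.r_inv, hx, hsy]), 𝒢.inv_inv]
        rw [this, map_mul, Complex.conj_conj]; ring
    _ = ∫ x, ∫ y, starRingEnd ℂ (η x) * (F (𝒢.mul x (𝒢.inv y)) * ξ y) ∂(H.measS u)
          ∂(H.measS u) := (integral_integral_swap hint).symm
    _ = _ := by
        refine integral_congr_ae ?_
        filter_upwards [H.regRep_ae' u F ξ] with x hx
        rw [hx, RCLike.inner_apply, integral_const_mul]; ring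

/-- The Hilbert space `L²(G_u) = L²(G, λ_u)`. -/
abbrev L2s (u : X) : Type _ := Lp ℂ 2 (H.measS u)

/-- The family `F ↦ (π_u(F))_u`. -/
def totalRep : C_c(G, ℂ) →ₗ[ℂ] OpProd H.L2s where
  toFun F := ⟨fun u => H.regRep u F, by
    obtain ⟨C, hC⟩ := H.exists_regRep_bound F
    exact memℓp_infty ⟨C, by rintro _ ⟨u, rfl⟩; exact hC u⟩⟩
  map_add' F F' := by ext1; funext u; exact H.regRep_add u F F'
  map_smul' c F := by ext1; funext u; exact H.regRep_smul u c F

theorem totalRep_conv (F F' : C_c(G, ℂ)) :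
    H.totalRep (H.convolve F F') = H.totalRep F * H.totalRep F' :=
  Subtype.ext (funext fun u => H.regRep_conv u F F')

theorem totalRep_invol (F : C_c(G, ℂ)) :
    H.totalRep (invol (𝒢 := 𝒢) F) = star (H.totalRep F) :=
  Subtype.ext (funext fun u => H.regRep_invol u F)

/-- The reduced C*-algebra: the completion of `C_c(G)` in the norm `sup_u ‖π_u(F)‖`, realised as
the norm closure of the image of `F ↦ (π_u(F))_u`; see `norm_toCStarRed` and
`denseRange_toCStarRed`. -/
def CStarRed : Type _ :=
  starClosure H.totalRep (fun F F' => ⟨_, H.totalRep_conv F F'⟩) (fun F => ⟨_, H.totalRep_invol F⟩)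

instance : NonUnitalCStarAlgebra H.CStarRed := starClosureCStar H.totalRep _ _

/-- The canonical map of `C_c(G)` into its completion. -/
def toCStarRed (F : C_c(G, ℂ)) : H.CStarRed :=
  ⟨H.totalRep F, subset_closure (Set.mem_range_self F)⟩

/-- `‖F‖_red = sup_u ‖π_u(F)‖`. -/
def normRed (F : C_c(G, ℂ)) : ℝ := ⨆ u, ‖H.regRep u F‖

theorem norm_toCStarRed (F : C_c(G, ℂ)) : ‖H.toCStarRed F‖ = H.normRed F :=
  lp.norm_eq_ciSup (H.totalRep F)

theorem denseRange_toCStarRed : DenseRange H.toCStarRed := by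
  rintro ⟨a, ha⟩
  refine closure_subtype.2 (closure_mono ?_ ha)
  rintro _ ⟨F, rfl⟩
  exact ⟨H.toCStarRed F, ⟨F, rfl⟩, rfl⟩

end HaarSystem
end

noncomputable section

section Adjointable
variable (A E : Type*) [NonUnitalCStarAlgebra A] [PartialOrder A] [NormedAddCommGroup E]
  [NormedSpace ℂ E] [SMul A E] [CStarModule A E]

/-- The algebra `𝔏(E)` of adjointable operators on a Hilbert module `E` over `A`, with the
operator norm. -/
def Adjointable : Subalgebra ℂ (E →L[ℂ] E) where
  carrier := {T | ∃ S : E →L[ℂ] E, ∀ ξ η, inner A (T ξ) η = inner A ξ (S η)}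
  mul_mem' := by
    rintro T T' ⟨S, hS⟩ ⟨S', hS'⟩
    exact ⟨S' * S, fun ξ η => by
      change inner A (T (T' ξ)) η = inner A ξ (S' (S η))
      rw [hS, hS']⟩
  add_mem' := by
    rintro T T' ⟨S, hS⟩ ⟨S', hS'⟩
    exact ⟨S + S', fun ξ η => by
      rw [add_apply, add_apply, CStarModule.inner_add_left,
        CStarModule.inner_add_right, hS, hS']⟩
  algebraMap_mem' c := ⟨algebraMap ℂ _ (star c), fun ξ η => by
    rw [Algebra.algebraMap_eq_smul_one, Algebra.algebraMap_eq_smul_one]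
    change inner A (c • ξ) η = inner A ξ (star c • η)
    rw [CStarModule.inner_smul_left_complex, CStarModule.inner_smul_right_complex]⟩

variable {A E}

theorem CStarModule.ext_inner {S S' : E →L[ℂ] E}
    (h : ∀ ξ η : E, inner A ξ (S η) = inner A ξ (S' η)) : S = S' := by
  ext η
  rw [← sub_eq_zero, ← CStarModule.inner_self (A := A) (x := S η - S' η),
    CStarModule.inner_sub_right, h, sub_self]

theorem Adjointable.exists_adjoint (T : Adjointable A E) : ∃ S : Adjointable A E,
    ∀ ξ η, inner A ((T : E →L[ℂ] E) ξ) η = inner A ξ ((S : E →L[ℂ] E) η) := by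
  obtain ⟨S, hS⟩ := T.2
  refine ⟨⟨S, T, fun ξ η => ?_⟩, hS⟩
  rw [← CStarModule.star_inner, ← hS, CStarModule.star_inner]

/-- The star of an adjointable operator is its adjoint. -/
instance : Star (Adjointable A E) := ⟨fun T => (Adjointable.exists_adjoint T).choose⟩

theorem Adjointable.inner_left (T : Adjointable A E) (ξ η : E) :
    inner A ((T : E →L[ℂ] E) ξ) η = inner A ξ ((star T : Adjointable A E).1 η) :=
  (Adjointable.exists_adjoint T).choose_spec ξ η

theorem Adjointable.eq_star {T S : Adjointable A E}
    (h : ∀ ξ η, inner A (T.1 ξ) η = inner A ξ (S.1 η)) : star T = S :=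
  Subtype.ext (CStarModule.ext_inner (A := A) fun ξ η => by rw [← Adjointable.inner_left T, h])

instance : StarRing (Adjointable A E) where
  star_involutive T := Adjointable.eq_star fun ξ η => by
    rw [← CStarModule.star_inner, ← Adjointable.inner_left T, CStarModule.star_inner]
  star_mul T S := Adjointable.eq_star fun ξ η => by
    change inner A (T.1 (S.1 ξ)) η = inner A ξ ((star S).1 ((star T).1 η))
    rw [Adjointable.inner_left T, Adjointable.inner_left S]
  star_add T S := Adjointable.eq_star fun ξ η => by
    change inner A (T.1 ξ + S.1 ξ) η = inner A ξ ((star T).1 η + (star S).1 η)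
    rw [CStarModule.inner_add_left, CStarModule.inner_add_right, Adjointable.inner_left T, Adjointable.inner_left S]

end Adjointable

section C0Order
variable (X : Type*) [TopologicalSpace X]
open scoped ComplexOrder

/-- The pointwise order on `C₀(X)`. -/
instance c0PartialOrder : PartialOrder C₀(X, ℂ) :=
  PartialOrder.lift (fun f => (f : X → ℂ)) DFunLike.coe_injective
end C0Order

namespace HaarSystem

variable {X G : Type*} [TopologicalSpace X] [TopologicalSpace G] [MeasurableSpace G]
  {𝒢 : TopGroupoid X G} (H : HaarSystem 𝒢)
  [T2Space G] [LocallyCompactSpace G] [SecondCountableTopology G] [BorelSpace G]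

/-- The Hilbert space `L²(G^u) = L²(G, λ^u)`. -/
abbrev L2r (u : X) : Type _ := Lp ℂ 2 (H.meas u)

theorem memLp_sec (f : C_c(G, ℂ)) (u : X) : MemLp f 2 (H.meas u) :=
  (map_continuous f).memLp_of_hasCompactSupport f.hasCompactSupport

/-- The section `u ↦ f^u` of `L²(G)` given by `f ∈ C_c(G)`. -/
def sec (f : C_c(G, ℂ)) (u : X) : H.L2r u := (H.memLp_sec f u).toLp f

theorem sec_add (f g : C_c(G, ℂ)) (u : X) : H.sec (f + g) u = H.sec f u + H.sec g u := rfl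

theorem sec_smul (c : ℂ) (f : C_c(G, ℂ)) (u : X) : H.sec (c • f) u = c • H.sec f u := rfl

theorem inner_sec (f g : C_c(G, ℂ)) (u : X) :
    inner ℂ (H.sec f u) (H.sec g u) = ∫ t, (star f * g) t ∂(H.meas u) := by
  rw [sec, sec, L2.inner_def]
  refine integral_congr_ae ?_
  filter_upwards [(H.memLp_sec f u).coeFn_toLp, (H.memLp_sec g u).coeFn_toLp] with t h1 h2
  rw [h1, h2, RCLike.inner_apply, mul_comm]
  rfl

theorem continuous_inner_sec (f g : C_c(G, ℂ)) :
    Continuous fun u => (inner ℂ (H.sec f u) (H.sec g u) : ℂ) := by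
  simp_rw [H.inner_sec]
  exact H.continuous_integral _

theorem continuous_norm_sec (f : C_c(G, ℂ)) : Continuous fun u => ‖H.sec f u‖ := by
  simp_rw [@norm_eq_sqrt_re_inner ℂ]
  exact (RCLike.continuous_re.comp (H.continuous_inner_sec f f)).sqrt

theorem sec_eq_zero (f : C_c(G, ℂ)) {u : X} (hu : u ∉ 𝒢.r '' tsupport f) : H.sec f u = 0 := by
  refine (Lp.eq_zero_iff_ae_eq_zero).2 ?_
  filter_upwards [(H.memLp_sec f u).coeFn_toLp, H.ae_r u] with t h1 h2
  refine h1.trans (image_eq_zero_of_notMem_tsupport fun h => hu ⟨t, h, h2⟩)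

/-- Continuity of a section of the bundle `L²(G) = {L²(G^u)}`: it is locally uniformly close to
sections given by functions in `C_c(G)`. -/
def IsContSection (ξ : ∀ u, H.L2r u) : Prop :=
  ∀ u₀, ∀ ε > 0, ∃ f : C_c(G, ℂ), ∀ᶠ u in 𝓝 u₀, ‖ξ u - H.sec f u‖ < ε

/-- `E²(G)`: the continuous sections of `L²(G)` that vanish at infinity, with the norm
`sup_u ‖ξ^u‖` (such sections are automatically bounded). -/
def E2 : Submodule ℂ (lp H.L2r ∞) where
  carrier := {ξ | H.IsContSection ξ ∧ Tendsto (fun u => ‖ξ u‖) (cocompact X) (𝓝 0)}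
  zero_mem' := ⟨fun u₀ ε hε => ⟨0, Eventually.of_forall fun u => by
    have : H.sec 0 u = 0 := rfl
    simpa [this] using hε⟩, by
    refine tendsto_const_nhds.congr fun u => ?_
    exact (norm_zero (E := H.L2r u)).symm⟩
  add_mem' := by
    rintro ξ η ⟨h1, h2⟩ ⟨h3, h4⟩
    refine ⟨fun u₀ ε hε => ?_, ?_⟩
    · obtain ⟨f, hf⟩ := h1 u₀ (ε / 2) (half_pos hε)
      obtain ⟨g, hg⟩ := h3 u₀ (ε / 2) (half_pos hε)
      refine ⟨f + g, ?_⟩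
      filter_upwards [hf, hg] with u hu hu'
      rw [H.sec_add]
      calc ‖(ξ + η : lp H.L2r ∞) u - (H.sec f u + H.sec g u)‖
          = ‖(ξ u - H.sec f u) + (η u - H.sec g u)‖ := by
            congr 1
            change ξ u + η u - _ = _
            abel
        _ ≤ _ := norm_add_le _ _
        _ < ε := by linarith
    · have := h2.add h4
      rw [add_zero] at this
      exact squeeze_zero (fun u => norm_nonneg _) (fun u => norm_add_le (ξ u) (η u)) this
  smul_mem' := by
    rintro c ξ ⟨h1, h2⟩
    refine ⟨fun u₀ ε hε => ?_, ?_⟩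
    · have hc : 0 < ‖c‖ + 1 := by positivity
      obtain ⟨f, hf⟩ := h1 u₀ (ε / (‖c‖ + 1)) (by positivity)
      refine ⟨c • f, ?_⟩
      filter_upwards [hf] with u hu
      rw [H.sec_smul]
      calc ‖(c • ξ : lp H.L2r ∞) u - c • H.sec f u‖ = ‖c‖ * ‖ξ u - H.sec f u‖ := by
            rw [← norm_smul, smul_sub]; rfl
        _ ≤ (‖c‖ + 1) * ‖ξ u - H.sec f u‖ := by gcongr; linarith
        _ < (‖c‖ + 1) * (ε / (‖c‖ + 1)) := by gcongr
        _ = ε := mul_div_cancel₀ _ hc.ne'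
    · have := h2.const_mul ‖c‖
      rw [mul_zero] at this
      refine this.congr fun u => ?_
      rw [← norm_smul]; rfl

/-- The inclusion `C_c(G) ⊆ E²`. -/
def ofCc : C_c(G, ℂ) →ₗ[ℂ] H.E2 where
  toFun f := ⟨⟨H.sec f, by
      have hK : IsCompact (𝒢.r '' tsupport f) :=
        f.hasCompactSupport.isCompact.image 𝒢.continuous_r
      obtain ⟨C, hC⟩ := (hK.image (H.continuous_norm_sec f)).isBounded.bddAbove
      refine memℓp_infty ⟨max C 0, ?_⟩
      rintro _ ⟨u, rfl⟩
      by_cases hu : u ∈ 𝒢.r '' tsupport f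
      · exact le_max_of_le_left (hC ⟨u, hu, rfl⟩)
      · simp [H.sec_eq_zero f hu]⟩,
    fun u₀ ε hε => ⟨f, Eventually.of_forall fun u => by
      change ‖H.sec f u - H.sec f u‖ < ε
      simpa using hε⟩, by
      have hK : IsCompact (𝒢.r '' tsupport f) :=
        f.hasCompactSupport.isCompact.image 𝒢.continuous_r
      refine tendsto_const_nhds.congr' ?_
      filter_upwards [hK.compl_mem_cocompact] with u hu
      rw [H.sec_eq_zero f hu, norm_zero]⟩
  map_add' f g := rfl
  map_smul' c f := rfl

theorem norm_apply_le (ξ : H.E2) (u : X) : ‖ξ.1 u‖ ≤ ‖ξ‖ :=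
  lp.norm_apply_le_norm ENNReal.top_ne_zero ξ.1 u

theorem continuous_inner (ξ η : H.E2) : Continuous fun u => (inner ℂ (ξ.1 u) (η.1 u) : ℂ) := by
  rw [continuous_iff_continuousAt]
  intro u₀
  refine continuousAt_of_locally_uniform_approx_of_continuousAt fun U hU => ?_
  obtain ⟨ε, hε, hεU⟩ := Metric.mem_uniformity_dist.1 hU
  set M := ‖ξ‖ + ‖η‖ + 1 with hM
  have hMpos : 0 < M := by positivity
  set δ := min 1 (ε / (2 * M)) with hδ
  have hδpos : 0 < δ := lt_min one_pos (by positivity)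
  obtain ⟨f, hf⟩ := ξ.2.1 u₀ δ hδpos
  obtain ⟨g, hg⟩ := η.2.1 u₀ δ hδpos
  refine ⟨_, hf.and hg, _, (H.continuous_inner_sec f g).continuousAt, ?_⟩
  rintro u ⟨hu1, hu2⟩
  refine hεU ?_
  rw [dist_eq_norm]
  have hgn : ‖H.sec g u‖ ≤ ‖η‖ + 1 := by
    calc ‖H.sec g u‖ = ‖η.1 u - (η.1 u - H.sec g u)‖ := by rw [sub_sub_cancel]
      _ ≤ ‖η.1 u‖ + ‖η.1 u - H.sec g u‖ := norm_sub_le _ _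
      _ ≤ ‖η‖ + 1 := add_le_add (H.norm_apply_le η u) (hu2.le.trans (min_le_left _ _))
  calc ‖(inner ℂ (ξ.1 u) (η.1 u) : ℂ) - inner ℂ (H.sec f u) (H.sec g u)‖
      = ‖(inner ℂ (ξ.1 u) (η.1 u - H.sec g u) : ℂ)
          + inner ℂ (ξ.1 u - H.sec f u) (H.sec g u)‖ := by
        rw [inner_sub_right, inner_sub_left]; congr 1; ring
    _ ≤ ‖ξ.1 u‖ * ‖η.1 u - H.sec g u‖ + ‖ξ.1 u - H.sec f u‖ * ‖H.sec g u‖ :=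
        (norm_add_le _ _).trans (add_le_add (norm_inner_le_norm _ _) (norm_inner_le_norm _ _))
    _ ≤ ‖ξ‖ * δ + δ * (‖η‖ + 1) := by
        gcongr
        exact H.norm_apply_le ξ u
    _ = M * δ := by rw [hM]; ring
    _ ≤ M * (ε / (2 * M)) := by gcongr; exact min_le_right _ _
    _ = ε / 2 := by field_simp
    _ < ε := half_lt_self hε

/-- The `C₀(X)`-valued inner product `⟨ξ, η⟩(u) = (ξ^u, η^u)`, conjugate linear in `ξ`. -/
def moduleInner (ξ η : H.E2) : C₀(X, ℂ) where
  toFun u := inner ℂ (ξ.1 u) (η.1 u)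
  continuous_toFun := H.continuous_inner ξ η
  zero_at_infty' := by
    refine squeeze_zero_norm (a := fun u => ‖ξ.1 u‖ * ‖η‖) (fun u => ?_) ?_
    · exact (norm_inner_le_norm _ _).trans (by gcongr; exact H.norm_apply_le η u)
    · simpa using ξ.2.2.mul_const ‖η‖

/-- The action `(b ξ)^u = b(u) ξ^u` of `C₀(X)` on `E²`. -/
instance : SMul C₀(X, ℂ) H.E2 where
  smul b ξ := ⟨⟨fun u => b u • ξ.1 u, by
      refine memℓp_infty ⟨‖b‖ * ‖ξ‖, ?_⟩
      rintro _ ⟨u, rfl⟩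
      change ‖b u • ξ.1 u‖ ≤ _
      rw [norm_smul]
      exact mul_le_mul (b.toBCF.norm_coe_le_norm u) (H.norm_apply_le ξ u) (norm_nonneg _)
        (norm_nonneg _)⟩, by
    constructor
    · intro u₀ ε hε
      have hb : 0 < ‖b‖ + 1 := by positivity
      obtain ⟨f, hf⟩ := ξ.2.1 u₀ (ε / (‖b‖ + 1)) (by positivity)
      let bf : C_c(G, ℂ) := ⟨⟨fun t => b (𝒢.r t) * f t,
        ((map_continuous b).comp 𝒢.continuous_r).mul (map_continuous f)⟩,
        f.hasCompactSupport.mul_left⟩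
      refine ⟨bf, ?_⟩
      filter_upwards [hf] with u hu
      have hs : H.sec bf u = b u • H.sec f u := by
        refine Lp.ext ?_
        filter_upwards [(H.memLp_sec f u).coeFn_toLp, (H.memLp_sec bf u).coeFn_toLp,
          Lp.coeFn_smul (b u) (H.sec f u), H.ae_r u] with t h1 h2 h3 h4
        refine h2.trans (Eq.trans ?_ h3.symm)
        change b (𝒢.r t) * f t = b u * _
        rw [h4]
        exact congrArg _ h1.symm
      rw [hs]
      calc ‖b u • ξ.1 u - b u • H.sec f u‖ = ‖b u‖ * ‖ξ.1 u - H.sec f u‖ := by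
            rw [← norm_smul, smul_sub]
        _ ≤ (‖b‖ + 1) * ‖ξ.1 u - H.sec f u‖ := by
            gcongr
            have := b.toBCF.norm_coe_le_norm u
            exact this.trans (by change ‖b‖ ≤ _; linarith)
        _ < (‖b‖ + 1) * (ε / (‖b‖ + 1)) := by gcongr
        _ = ε := mul_div_cancel₀ _ hb.ne'
    · refine squeeze_zero (g := fun u => ‖b‖ * ‖ξ.1 u‖) (fun u => norm_nonneg _) (fun u => ?_) ?_
      · change ‖b u • ξ.1 u‖ ≤ _
        rw [norm_smul]
        gcongr
        exact b.toBCF.norm_coe_le_norm u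
      · simpa using ξ.2.2.const_mul ‖b‖⟩

section
open scoped ComplexOrder

/-- `E²` is a Hilbert module over `D = C₀(X)`. -/
instance : CStarModule C₀(X, ℂ) H.E2 where
  inner ξ η := H.moduleInner ξ η
  inner_add_right {ξ η ζ} := by
    ext u; exact inner_add_right (ξ.1 u) (η.1 u) (ζ.1 u)
  inner_self_nonneg {ξ} := fun u => by
    change 0 ≤ (inner ℂ (ξ.1 u) (ξ.1 u) : ℂ)
    rw [inner_self_eq_norm_sq_to_K]
    simp
  inner_self {ξ} := by
    constructor
    · intro h
      refine Subtype.ext (lp.ext (funext fun u => ?_))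
      have := DFunLike.congr_fun h u
      exact inner_self_eq_zero.1 (this : (inner ℂ (ξ.1 u) (ξ.1 u) : ℂ) = 0)
    · rintro rfl
      ext u; exact inner_zero_right (𝕜 := ℂ) (0 : H.L2r u)
  inner_op_smul_right {b ξ η} := by
    ext u; exact inner_smul_right (ξ.1 u) (η.1 u) (b u)
  inner_smul_right_complex {z ξ η} := by
    ext u; exact inner_smul_right (ξ.1 u) (η.1 u) z
  star_inner ξ η := by
    ext u; exact inner_conj_symm (η.1 u) (ξ.1 u)
  norm_eq_sqrt_norm_inner_self ξ := by
    have hpt : ∀ u, ‖H.moduleInner ξ ξ u‖ = ‖ξ.1 u‖ ^ 2 := fun u => by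
      change ‖(inner ℂ (ξ.1 u) (ξ.1 u) : ℂ)‖ = _
      rw [inner_self_eq_norm_sq_to_K]; simp
    refine le_antisymm ?_ ?_
    · refine lp.norm_le_of_forall_le (Real.sqrt_nonneg _) fun u => Real.le_sqrt_of_sq_le ?_
      refine (hpt u).symm.le.trans ?_
      exact (H.moduleInner ξ ξ).toBCF.norm_coe_le_norm u
    · refine Real.sqrt_le_iff.2 ⟨norm_nonneg _, ?_⟩
      refine ((H.moduleInner ξ ξ).toBCF.norm_le (by positivity)).2 fun u => ?_
      refine (hpt u).le.trans ?_
      gcongr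
      exact H.norm_apply_le ξ u

end

/-- `‖F‖_{I,r} = sup_u ∫ |F| dλ^u`. -/
def normIr (F : C_c(G, ℂ)) : ℝ := ⨆ u, ∫ t, ‖F t‖ ∂(H.meas u)

/-- `‖F‖_{I,s} = sup_u ∫ |F| dλ_u`. -/
def normIs (F : C_c(G, ℂ)) : ℝ := ⨆ u, ∫ t, ‖F t‖ ∂(H.measS u)

/-- `‖F‖_I`, the maximum of the two norms. -/
def normI (F : C_c(G, ℂ)) : ℝ := max (H.normIr F) (H.normIs F)

end HaarSystem
end

noncomputable section
namespace HaarSystem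

variable {X G : Type*} [TopologicalSpace X] [TopologicalSpace G] [MeasurableSpace G]
  {𝒢 : TopGroupoid X G} (H : HaarSystem 𝒢)
  [T2Space G] [LocallyCompactSpace G] [SecondCountableTopology G] [BorelSpace G]

/-! ### Transport between the fibres of the range and source maps -/

/-! Inversion carries `λ_u` to `λ^u`, so `ξ ↦ ξ ∘ inv` is a unitary `U_u : L²(G^u) → L²(G_u)`. A
change of variables (`invL2_symm_regRep_sec`) gives `U_u⁻¹ π_u(F) U_u f^u = (f * F^∨)^u`: seen
through these unitaries, right convolution is the regular representation, up to the flip `F ↦ F^∨`.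
It is therefore enough to let all of `C*_red(G)` act on `E²`, an element `a = (a_u)` acting by
`U_u⁻¹ a_u U_u` on each fibre, and to put `R_F = Φ(F^∨)`. No extension of `Φ` from `C_c(G)` is
needed.

The first point is that this action preserves continuity of sections (`isContSection_fibre`). If `a`
comes from `F ∈ C_c(G)` and the section from `f ∈ C_c(G)`, the result is the section of `f * F^∨`;
the general case follows by approximating both `a` and the section. Adjoints, products and linear
combinations can then be computed fibre by fibre.

The second point is that `Φ` is isometric (`norm_fibreOp`). Clearly `‖Φ(a)‖ ≤ sup_u ‖a_u‖`. For the
converse, a vector `f^u` of a single fibre is the value at `u` of a section of `E²` of no larger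
norm (`exists_sec_eq_of_norm_le`), and such vectors are dense in `L²(G^u)`, so each `‖a_u‖` is seen
by `Φ(a)`.

The remaining claims are about the flip. It reverses convolution products (`check_convolve`), whence
the antirepresentation. It preserves the reduced norm (`normRed_check`), because `F^∨` is the
complex conjugate of `F^*`. The bound by `‖F‖_I` is Schur's test for the kernel `F(x y⁻¹)` on
`L²(G_u)`. -/

theorem measurePreserving_inv (u : X) : MeasurePreserving 𝒢.inv (H.meas u) (H.measS u) :=
  ⟨𝒢.continuous_inv.measurable, rfl⟩

theorem measurePreserving_inv' (u : X) : MeasurePreserving 𝒢.inv (H.measS u) (H.meas u) :=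
  ⟨𝒢.continuous_inv.measurable, H.inv_measS u⟩

/-- The unitary `L²(G^u) ≃ L²(G_u)`, `ξ ↦ ξ ∘ inv`. -/
def invL2 (u : X) : H.L2r u ≃ₗᵢ[ℂ] H.L2s u where
  toLinearEquiv := LinearEquiv.ofLinearMap
    (Lp.compMeasurePreservingₗ ℂ 𝒢.inv (H.measurePreserving_inv' u))
    (Lp.compMeasurePreservingₗ ℂ 𝒢.inv (H.measurePreserving_inv u))
    (by
      ext1 ξ
      refine Lp.ext ?_
      have h1 := Lp.coeFn_compMeasurePreserving ξ (H.measurePreserving_inv u)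
      have h2 := Lp.coeFn_compMeasurePreserving
        (Lp.compMeasurePreserving 𝒢.inv (H.measurePreserving_inv u) ξ)
        (H.measurePreserving_inv' u)
      filter_upwards [h2, (H.measurePreserving_inv' u).quasiMeasurePreserving.ae h1] with x hx hx'
      refine hx.trans (hx'.trans ?_)
      simp [𝒢.inv_inv])
    (by
      ext1 ξ
      refine Lp.ext ?_
      have h1 := Lp.coeFn_compMeasurePreserving ξ (H.measurePreserving_inv' u)
      have h2 := Lp.coeFn_compMeasurePreserving
        (Lp.compMeasurePreserving 𝒢.inv (H.measurePreserving_inv' u) ξ)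
        (H.measurePreserving_inv u)
      filter_upwards [h2, (H.measurePreserving_inv u).quasiMeasurePreserving.ae h1] with x hx hx'
      refine hx.trans (hx'.trans ?_)
      simp [𝒢.inv_inv])
  norm_map' ξ := Lp.norm_compMeasurePreserving ξ (H.measurePreserving_inv' u)

theorem invL2_ae (u : X) (ξ : H.L2r u) : H.invL2 u ξ =ᵐ[H.measS u] ξ ∘ 𝒢.inv :=
  Lp.coeFn_compMeasurePreserving ξ (H.measurePreserving_inv' u)

theorem invL2_symm_ae (u : X) (ξ : H.L2s u) : (H.invL2 u).symm ξ =ᵐ[H.meas u] ξ ∘ 𝒢.inv :=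
  Lp.coeFn_compMeasurePreserving ξ (H.measurePreserving_inv u)

/-- On the fibre over `u`, right convolution by `F` is the regular representation of `F^∨`. -/
theorem invL2_symm_regRep_sec (F f : C_c(G, ℂ)) (u : X) :
    (H.invL2 u).symm (H.regRep u F (H.invL2 u (H.sec f u))) =
      H.sec (H.convolve f (check (𝒢 := 𝒢) F)) u := by
  refine Lp.ext ?_
  have h1 := H.invL2_symm_ae u (H.regRep u F (H.invL2 u (H.sec f u)))
  have h2 := (H.measurePreserving_inv u).quasiMeasurePreserving.ae
    (H.regRep_ae' u F (H.invL2 u (H.sec f u)))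
  have h3 := (H.memLp_sec (H.convolve f (check (𝒢 := 𝒢) F)) u).coeFn_toLp
  filter_upwards [h1, h2, h3, H.ae_r u] with x hx1 hx2 hx3 hxr
  refine hx1.trans (hx2.trans (Eq.trans ?_ hx3.symm))
  change _ = ∫ t, f t * F (𝒢.inv (𝒢.mul (𝒢.inv t) x)) ∂(H.meas (𝒢.r x))
  subst hxr
  have h4 : ∀ᵐ y ∂(H.measS (𝒢.r x)), H.invL2 _ (H.sec f (𝒢.r x)) y = f (𝒢.inv y) := by
    filter_upwards [H.invL2_ae (𝒢.r x) (H.sec f (𝒢.r x)),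
      (H.measurePreserving_inv' (𝒢.r x)).quasiMeasurePreserving.ae
        (H.memLp_sec f (𝒢.r x)).coeFn_toLp] with y hy hy'
    exact hy.trans hy'
  have h5 : ∫ y, F (𝒢.mul (𝒢.inv x) (𝒢.inv y)) * H.invL2 _ (H.sec f (𝒢.r x)) y
      ∂(H.measS (𝒢.r x)) =
      ∫ y, f (𝒢.inv y) * F (𝒢.mul (𝒢.inv x) (𝒢.inv y)) ∂(H.measS (𝒢.r x)) := by
    refine integral_congr_ae ?_
    filter_upwards [h4] with y hy
    rw [hy, mul_comm]
  rw [h5]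
  -- The kernel form at `x⁻¹` is `∫ f(y⁻¹) F(x⁻¹ y⁻¹) dλ_u(y)`. Substituting `t = y⁻¹` gives `∫ f(t)
  -- F(x⁻¹ t) dλ^u(t)`, and `x⁻¹ t = (t⁻¹ x)⁻¹`.
  have h6 := (H.measurePreserving_inv' (𝒢.r x)).integral_comp
    (𝒢.invHomeo.measurableEmbedding) (fun t => f t * F (𝒢.mul (𝒢.inv x) t))
  refine h6.trans (integral_congr_ae ?_)
  filter_upwards [H.ae_r (𝒢.r x)] with t ht
  rw [𝒢.mul_inv_rev ((𝒢.s_inv t).trans ht), 𝒢.inv_inv]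

theorem check_check (F : C_c(G, ℂ)) : check (𝒢 := 𝒢) (check (𝒢 := 𝒢) F) = F := by
  ext x
  exact congrArg F (𝒢.inv_inv x)

/-! ### Fibrewise operators on `E²` -/

theorem norm_coe_apply_le (a : OpProd H.L2s) (u : X) : ‖a u‖ ≤ ‖a‖ :=
  lp.norm_apply_le_norm ENNReal.top_ne_zero a u

theorem norm_fibre_le (a : OpProd H.L2s) (u : X) (ξ : H.L2r u) :
    ‖(H.invL2 u).symm (a u (H.invL2 u ξ))‖ ≤ ‖a‖ * ‖ξ‖ := by
  rw [LinearIsometryEquiv.norm_map]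
  refine ((a u).le_opNorm _).trans ?_
  rw [LinearIsometryEquiv.norm_map]
  gcongr
  exact H.norm_coe_apply_le a u

/-- Elements of `C*_red(G)` map continuous sections to continuous sections. -/
theorem isContSection_fibre (a : H.CStarRed) (ξ : H.E2) :
    H.IsContSection fun u => (H.invL2 u).symm (a.1 u (H.invL2 u (ξ.1 u))) := by
  intro u₀ ε hε
  have hξ : 0 < ‖ξ‖ + 1 := by positivity
  -- Two approximations, each costing `ε / 2`: `a` by `F` in norm, then `ξ` by `f` near `u₀` with a
  -- tolerance depending on `F`. The `+ 1` keeps the denominators positive.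
  obtain ⟨_, ⟨F, rfl⟩, hF⟩ := Metric.mem_closure_iff.1 a.2 (ε / 2 / (‖ξ‖ + 1)) (by positivity)
  have hF' : ‖a.1 - H.totalRep F‖ < ε / 2 / (‖ξ‖ + 1) := by rwa [← dist_eq_norm]
  have hb : 0 < ‖H.totalRep F‖ + 1 := by positivity
  obtain ⟨f, hf⟩ := ξ.2.1 u₀ (ε / 2 / (‖H.totalRep F‖ + 1)) (by positivity)
  refine ⟨H.convolve f (check (𝒢 := 𝒢) F), ?_⟩
  filter_upwards [hf] with u hu
  rw [← H.invL2_symm_regRep_sec]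
  -- The usual splitting `aξ - Ff = (a - F)ξ + F(ξ - f)`, transported to the fibre over `u`.
  have e : (H.invL2 u).symm (a.1 u (H.invL2 u (ξ.1 u))) -
        (H.invL2 u).symm (H.regRep u F (H.invL2 u (H.sec f u))) =
      (H.invL2 u).symm ((a.1 - H.totalRep F) u (H.invL2 u (ξ.1 u))) +
        (H.invL2 u).symm (H.totalRep F u (H.invL2 u (ξ.1 u - H.sec f u))) := by
    rw [← map_sub, ← map_add, map_sub (H.invL2 u), map_sub (H.totalRep F u)]
    congr 1
    change _ = a.1 u _ - H.regRep u F _ + (H.regRep u F _ - H.regRep u F _)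
    abel
  rw [e]
  calc _ ≤ ‖a.1 - H.totalRep F‖ * ‖ξ.1 u‖ + ‖H.totalRep F‖ * ‖ξ.1 u - H.sec f u‖ :=
        (norm_add_le _ _).trans (add_le_add (H.norm_fibre_le _ u _) (H.norm_fibre_le _ u _))
    _ ≤ (ε / 2 / (‖ξ‖ + 1)) * (‖ξ‖ + 1) + (‖H.totalRep F‖ + 1) * ‖ξ.1 u - H.sec f u‖ := by
        gcongr
        · exact (H.norm_apply_le ξ u).trans (by linarith)
        · linarith
    _ < (ε / 2 / (‖ξ‖ + 1)) * (‖ξ‖ + 1) +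
          (‖H.totalRep F‖ + 1) * (ε / 2 / (‖H.totalRep F‖ + 1)) := by gcongr
    _ = ε := by field_simp; ring

/-- The operator `(a ξ)^u = U_u⁻¹ a_u U_u ξ^u` on `E²`, with `U_u : L²(G^u) ≃ L²(G_u)`. -/
def fibreOp (a : H.CStarRed) : H.E2 →L[ℂ] H.E2 :=
  LinearMap.mkContinuous
    { toFun := fun ξ => ⟨⟨fun u => (H.invL2 u).symm (a.1 u (H.invL2 u (ξ.1 u))), by
          refine memℓp_infty ⟨‖a.1‖ * ‖ξ‖, ?_⟩
          rintro _ ⟨u, rfl⟩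
          refine (H.norm_fibre_le a.1 u (ξ.1 u)).trans ?_
          gcongr
          exact H.norm_apply_le ξ u⟩,
        H.isContSection_fibre a ξ, by
          refine squeeze_zero (fun u => norm_nonneg _)
            (fun u => H.norm_fibre_le a.1 u (ξ.1 u)) ?_
          simpa using ξ.2.2.const_mul ‖a.1‖⟩
      map_add' := fun ξ η => by
        refine Subtype.ext (lp.ext (funext fun u => ?_))
        change (H.invL2 u).symm (a.1 u (H.invL2 u (ξ.1 u + η.1 u))) =
          (H.invL2 u).symm (a.1 u (H.invL2 u (ξ.1 u))) +
            (H.invL2 u).symm (a.1 u (H.invL2 u (η.1 u)))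
        simp only [map_add]
      map_smul' := fun c ξ => by
        refine Subtype.ext (lp.ext (funext fun u => ?_))
        change (H.invL2 u).symm (a.1 u (H.invL2 u (c • ξ.1 u))) =
          c • (H.invL2 u).symm (a.1 u (H.invL2 u (ξ.1 u)))
        simp only [map_smul] }
    ‖a.1‖ fun ξ => by
      refine lp.norm_le_of_forall_le (by positivity) fun u => ?_
      refine (H.norm_fibre_le a.1 u (ξ.1 u)).trans ?_
      gcongr
      exact H.norm_apply_le ξ u

theorem fibreOp_apply (a : H.CStarRed) (ξ : H.E2) (u : X) :
    (H.fibreOp a ξ).1 u = (H.invL2 u).symm (a.1 u (H.invL2 u (ξ.1 u))) := rfl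

theorem norm_fibreOp_le (a : H.CStarRed) : ‖H.fibreOp a‖ ≤ ‖a.1‖ :=
  LinearMap.mkContinuous_norm_le _ (norm_nonneg _) _

/-- The inner product is taken in each fibre, each `U_u` is unitary, and the star of `a` is the
family of Hilbert space adjoints of the `a_u`. This is what makes `fibreOp a` adjointable and the
representation compatible with stars. -/
theorem inner_fibreOp (a : H.CStarRed) (ξ η : H.E2) :
    inner C₀(X, ℂ) (H.fibreOp a ξ) η = inner C₀(X, ℂ) ξ (H.fibreOp (star a) η) := by
  ext u
  change (inner ℂ ((H.invL2 u).symm (a.1 u (H.invL2 u (ξ.1 u)))) (η.1 u) : ℂ) =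
    inner ℂ (ξ.1 u) ((H.invL2 u).symm (star (a.1 u) (H.invL2 u (η.1 u))))
  rw [← (H.invL2 u).inner_map_map, ← (H.invL2 u).inner_map_map (ξ.1 u),
    LinearIsometryEquiv.apply_symm_apply, LinearIsometryEquiv.apply_symm_apply,
    ContinuousLinearMap.star_eq_adjoint, ContinuousLinearMap.adjoint_inner_right]

/-- The representation of `C*_red(G)` by adjointable operators on `E²`. -/
def moduleRep : H.CStarRed →⋆ₙₐ[ℂ] Adjointable C₀(X, ℂ) H.E2 where
  toFun a := ⟨H.fibreOp a, H.fibreOp (star a), H.inner_fibreOp a⟩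
  map_smul' c a := by
    refine Subtype.ext (ContinuousLinearMap.ext fun ξ =>
      Subtype.ext (lp.ext (funext fun u => ?_)))
    exact map_smul (H.invL2 u).symm c (a.1 u (H.invL2 u (ξ.1 u)))
  map_zero' := by
    refine Subtype.ext (ContinuousLinearMap.ext fun ξ =>
      Subtype.ext (lp.ext (funext fun u => ?_)))
    exact map_zero (H.invL2 u).symm
  map_add' a b := by
    refine Subtype.ext (ContinuousLinearMap.ext fun ξ =>
      Subtype.ext (lp.ext (funext fun u => ?_)))
    exact map_add (H.invL2 u).symm (a.1 u (H.invL2 u (ξ.1 u))) (b.1 u (H.invL2 u (ξ.1 u)))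
  map_mul' a b := by
    refine Subtype.ext (ContinuousLinearMap.ext fun ξ =>
      Subtype.ext (lp.ext (funext fun u => ?_)))
    change (H.invL2 u).symm (a.1 u (b.1 u (H.invL2 u (ξ.1 u)))) =
      (H.invL2 u).symm (a.1 u (H.invL2 u ((H.invL2 u).symm (b.1 u (H.invL2 u (ξ.1 u))))))
    rw [LinearIsometryEquiv.apply_symm_apply]
  map_star' a := (Adjointable.eq_star (H.inner_fibreOp a)).symm

/-! ### The representation is isometric -/

/-- With `c = ‖f^u‖`, multiply `f` by `b ∘ r`, where `b(v) = c / max(‖f^v‖, c)`. This function is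
continuous because `v ↦ ‖f^v‖` is; it equals `1` at `u` and brings every fibre norm down to at most
`c`. The sup norm on `E²` can thus be tested on a single fibre. -/
theorem exists_sec_eq_of_norm_le (f : C_c(G, ℂ)) (u : X) :
    ∃ g : C_c(G, ℂ), H.sec g u = H.sec f u ∧ ‖H.ofCc g‖ ≤ ‖H.sec f u‖ := by
  -- For `c = 0` the quotient defining `b` may have a zero denominator; the zero function serves
  -- instead.
  rcases (norm_nonneg (H.sec f u)).eq_or_lt with h0 | hc
  · refine ⟨0, ?_, ?_⟩
    · rw [norm_eq_zero.1 h0.symm]; rfl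
    · rw [map_zero, norm_zero]; exact norm_nonneg _
  set c := ‖H.sec f u‖ with hcdef
  have hm : ∀ v, 0 < max ‖H.sec f v‖ c := fun v => lt_max_of_lt_right hc
  let b : X → ℂ := fun v => ((c / max ‖H.sec f v‖ c : ℝ) : ℂ)
  have hb : Continuous b := Complex.continuous_ofReal.comp
    (continuous_const.div ((H.continuous_norm_sec f).max continuous_const) fun v => (hm v).ne')
  let g : C_c(G, ℂ) := ⟨⟨fun t => b (𝒢.r t) * f t,
    (hb.comp 𝒢.continuous_r).mul (map_continuous f)⟩, f.hasCompactSupport.mul_left⟩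
  have hg : ∀ v, H.sec g v = b v • H.sec f v := fun v => by
    refine Lp.ext ?_
    filter_upwards [(H.memLp_sec f v).coeFn_toLp, (H.memLp_sec g v).coeFn_toLp,
      Lp.coeFn_smul (b v) (H.sec f v), H.ae_r v] with t h1 h2 h3 h4
    refine h2.trans (Eq.trans ?_ h3.symm)
    change b (𝒢.r t) * f t = b v * _
    rw [h4]
    exact congrArg _ h1.symm
  refine ⟨g, ?_, ?_⟩
  · rw [hg]
    have : b u = 1 := by simp [b, ← hcdef, hc.ne']
    rw [this, one_smul]
  · refine lp.norm_le_of_forall_le hc.le fun v => ?_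
    change ‖H.sec g v‖ ≤ c
    rw [hg, norm_smul, Complex.norm_of_nonneg (div_nonneg hc.le (hm v).le), div_mul_eq_mul_div,
      div_le_iff₀ (hm v)]
    gcongr
    exact le_max_left _ _

/-- Continuous compactly supported functions are dense in `L²` of a regular Borel measure, and `λ^u`
is regular, being finite on compact sets of a second countable locally compact Hausdorff space. -/
theorem denseRange_sec (u : X) : DenseRange fun f : C_c(G, ℂ) => H.sec f u := by
  intro ξ
  refine Metric.mem_closure_iff.2 fun ε hε => ?_
  obtain ⟨g, hg, hgε, hgc, hgm⟩ := (Lp.memLp ξ).exists_hasCompactSupport_eLpNorm_sub_le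
    (p := 2) (by norm_num) (ε := ENNReal.ofReal (ε / 2)) (by simpa using hε)
  refine ⟨_, ⟨⟨⟨g, hgc⟩, hg⟩, rfl⟩, ?_⟩
  have e : ξ - H.sec ⟨⟨g, hgc⟩, hg⟩ u = ((Lp.memLp ξ).sub hgm).toLp := by
    rw [MemLp.toLp_sub (Lp.memLp ξ) hgm, Lp.toLp_coeFn]; rfl
  rw [dist_eq_norm, e, Lp.norm_toLp]
  exact (ENNReal.toReal_le_of_le_ofReal (by positivity) hgε).trans_lt (half_lt_self hε)

/-- Both sides are continuous in `ξ`, so by density `ξ = f^u` may be assumed. Then `fibreOp a` is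
applied to a section through `f^u` of norm at most `‖f^u‖`, and the result is evaluated at `u`. -/
theorem norm_apply_le_norm_fibreOp (a : H.CStarRed) (u : X) (ξ : H.L2r u) :
    ‖a.1 u (H.invL2 u ξ)‖ ≤ ‖H.fibreOp a‖ * ‖ξ‖ := by
  have hcont : Continuous fun ξ : H.L2r u => ‖a.1 u (H.invL2 u ξ)‖ :=
    ((a.1 u).continuous.comp (H.invL2 u).continuous).norm
  have hcl : IsClosed {ξ : H.L2r u | ‖a.1 u (H.invL2 u ξ)‖ ≤ ‖H.fibreOp a‖ * ‖ξ‖} :=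
    isClosed_le hcont (continuous_const.mul continuous_norm)
  refine (H.denseRange_sec u).induction_on ξ hcl fun f => ?_
  obtain ⟨g, hg, hgn⟩ := H.exists_sec_eq_of_norm_le f u
  have h1 := H.norm_apply_le (H.fibreOp a (H.ofCc g)) u
  rw [fibreOp_apply, LinearIsometryEquiv.norm_map] at h1
  have h2 : (H.ofCc g).1 u = H.sec f u := hg
  rw [h2] at h1
  exact (h1.trans ((H.fibreOp a).le_opNorm _)).trans
    (mul_le_mul_of_nonneg_left hgn (ContinuousLinearMap.opNorm_nonneg _))

theorem norm_fibreOp (a : H.CStarRed) : ‖H.fibreOp a‖ = ‖a.1‖ := by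
  refine le_antisymm (H.norm_fibreOp_le a) ?_
  have h0 := ContinuousLinearMap.opNorm_nonneg (H.fibreOp a)
  refine lp.norm_le_of_forall_le h0 fun u => ?_
  refine ContinuousLinearMap.opNorm_le_bound _ h0 fun η => ?_
  have h := H.norm_apply_le_norm_fibreOp a u ((H.invL2 u).symm η)
  rwa [LinearIsometryEquiv.norm_map, LinearIsometryEquiv.apply_symm_apply] at h

theorem norm_moduleRep (a : H.CStarRed) : ‖H.moduleRep a‖ = ‖a‖ := H.norm_fibreOp a

/-! ### Comparison of norms -/

/-- Let `J` be pointwise complex conjugation, an antilinear isometry of `L²(G_u)`. Since `F^∨` is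
the conjugate of `F^*`, `π_u(F^∨) = J π_u(F^*) J`, and `π_u(F^*)` is the adjoint of `π_u(F)`, hence
has the same norm. -/
theorem norm_regRep_check_le (F : C_c(G, ℂ)) (u : X) :
    ‖H.regRep u (check (𝒢 := 𝒢) F)‖ ≤ ‖H.regRep u F‖ := by
  rw [← norm_star (H.regRep u F), ← H.regRep_invol]
  refine ContinuousLinearMap.opNorm_le_bound _ (norm_nonneg _) fun ξ => ?_
  have hn : ∀ η : H.L2s u, ‖star η‖ = ‖η‖ := fun η => by
    rw [Lp.norm_def, Lp.norm_def]
    refine congrArg ENNReal.toReal (eLpNorm_congr_norm_ae ?_)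
    filter_upwards [Lp.coeFn_star η] with x hx
    rw [hx, Pi.star_apply, norm_star]
  have e : H.regRep u (check (𝒢 := 𝒢) F) ξ = star (H.regRep u (invol (𝒢 := 𝒢) F) (star ξ)) := by
    refine Lp.ext ?_
    filter_upwards [H.regRep_ae' u (check (𝒢 := 𝒢) F) ξ,
      H.regRep_ae' u (invol (𝒢 := 𝒢) F) (star ξ),
      Lp.coeFn_star (H.regRep u (invol (𝒢 := 𝒢) F) (star ξ))] with x h1 h2 h3
    rw [h1, h3, Pi.star_apply, h2]
    refine Eq.trans (integral_congr_ae ?_) integral_conj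
    filter_upwards [Lp.coeFn_star ξ] with y hy
    rw [hy, map_mul, Pi.star_apply]
    exact congrArg₂ _ (Complex.conj_conj _).symm (Complex.conj_conj _).symm
  rw [e, hn, ← hn ξ]
  exact ContinuousLinearMap.le_opNorm _ _

theorem normRed_check (F : C_c(G, ℂ)) : H.normRed (check (𝒢 := 𝒢) F) = H.normRed F := by
  refine iSup_congr fun u => le_antisymm (H.norm_regRep_check_le F u) ?_
  -- The flip is an involution, so the same inequality for `F^∨` is the reverse one.
  have := H.norm_regRep_check_le (check (𝒢 := 𝒢) F) u
  rwa [check_check] at this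

/-! ### The bound of the reduced norm by the `I`-norm -/

theorem lintegral_le_normIr (F : C_c(G, ℂ)) (u : X) :
    ∫⁻ t, ‖F t‖ₑ ∂(H.meas u) ≤ ENNReal.ofReal (H.normIr F) := by
  obtain ⟨C, hC⟩ := H.exists_bound F
  have hi : ∀ v, ENNReal.ofReal (∫ t, ‖F t‖ ∂(H.meas v)) = ∫⁻ t, ‖F t‖ₑ ∂(H.meas v) := fun v =>
    ofReal_integral_norm_eq_lintegral_enorm
      ((map_continuous F).integrable_of_hasCompactSupport F.hasCompactSupport)
  rw [← hi]
  -- A real supremum dominates its terms only if the family is bounded above; `C` is such a bound.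
  refine ENNReal.ofReal_le_ofReal (le_ciSup (f := fun v => ∫ t, ‖F t‖ ∂(H.meas v)) ⟨C, ?_⟩ u)
  rintro _ ⟨v, rfl⟩
  have h := (hi v).trans_le (hC v)
  rw [← ENNReal.ofReal_coe_nnreal] at h
  exact (ENNReal.ofReal_le_ofReal_iff C.2).1 h

theorem normIr_check (F : C_c(G, ℂ)) : H.normIr (check (𝒢 := 𝒢) F) = H.normIs F :=
  iSup_congr fun u => ((H.measurePreserving_inv u).integral_comp
    𝒢.invHomeo.measurableEmbedding fun t => ‖F t‖)

/-- Schur's test for the kernel `F(x y⁻¹)`: by invariance its row integrals are `∫ |F| dλ^{r(x)}`,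
and its column integrals are those of `F^∨`, which `normIr_check` bounds by the source half of the
`I`-norm. -/
theorem norm_regRep_le_normI (F : C_c(G, ℂ)) (u : X) : ‖H.regRep u F‖ ≤ H.normI F := by
  have h0 : 0 ≤ H.normI F :=
    le_max_of_le_left (Real.iSup_nonneg fun u => integral_nonneg fun t => norm_nonneg _)
  have h₁ : ∀ᵐ x ∂(H.measS u), ∫⁻ y, ‖F (𝒢.mul x (𝒢.inv y))‖ₑ ∂(H.measS u) ≤
      ((H.normI F).toNNReal : ℝ≥0∞) := by
    filter_upwards [H.ae_s u] with x hx
    subst hx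
    rw [H.lintegral_kernel]
    exact (H.lintegral_le_normIr F _).trans (ENNReal.ofReal_le_ofReal (le_max_left _ _))
  have h₂ : ∀ᵐ y ∂(H.measS u), ∫⁻ x, ‖F (𝒢.mul x (𝒢.inv y))‖ₑ ∂(H.measS u) ≤
      ((H.normI F).toNNReal : ℝ≥0∞) := by
    filter_upwards [H.ae_s u] with y hy
    subst hy
    -- Since `F(x y⁻¹) = F^∨(y x⁻¹)`, a column of the kernel of `F` is a row of the kernel of `F^∨`.
    have : ∫⁻ x, ‖F (𝒢.mul x (𝒢.inv y))‖ₑ ∂(H.measS (𝒢.s y)) =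
        ∫⁻ x, ‖check (𝒢 := 𝒢) F (𝒢.mul y (𝒢.inv x))‖ₑ ∂(H.measS (𝒢.s y)) := by
      refine lintegral_congr_ae ?_
      filter_upwards [H.ae_s (𝒢.s y)] with x hx
      change _ = ‖F (𝒢.inv (𝒢.mul y (𝒢.inv x)))‖ₑ
      rw [𝒢.mul_inv_rev (by rw [𝒢.r_inv, hx]), 𝒢.inv_inv]
    rw [this, H.lintegral_kernel]
    refine (H.lintegral_le_normIr _ _).trans (ENNReal.ofReal_le_ofReal ?_)
    rw [normIr_check]
    exact le_max_right _ _
  refine ContinuousLinearMap.opNorm_le_bound _ h0 fun ξ => ?_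
  have h := (schur_memLp (H.aestronglyMeasurable_kernel F u) (Lp.memLp ξ) h₁ h₂).2
  rw [← eLpNorm_congr_ae (H.regRep_ae' u F ξ)] at h
  have := ENNReal.toReal_mono (ENNReal.mul_ne_top ENNReal.coe_ne_top (Lp.memLp ξ).2.ne) h
  rw [ENNReal.toReal_mul, ENNReal.coe_toReal, Real.coe_toNNReal _ h0] at this
  rwa [Lp.norm_def, Lp.norm_def]

theorem normRed_le_normI (F : C_c(G, ℂ)) : H.normRed F ≤ H.normI F :=
  Real.iSup_le (H.norm_regRep_le_normI F)
    -- Nonnegativity of the bound covers an empty unit space, where the supremum is `0`.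
    (le_max_of_le_left (Real.iSup_nonneg fun _ => integral_nonneg fun _ => norm_nonneg _))

/-! ### Right convolution -/

/-- The operator `R_F` of right convolution by `F`. -/
def rightConv : C_c(G, ℂ) →ₗ[ℂ] Adjointable C₀(X, ℂ) H.E2 where
  -- On the fibres `π_u(F)` becomes right convolution by `F^∨`, so `F^∨` is inserted here to obtain
  -- right convolution by `F`.
  toFun F := H.moduleRep (H.toCStarRed (check (𝒢 := 𝒢) F))
  map_add' F F' :=
    have h : H.toCStarRed (check (𝒢 := 𝒢) (F + F')) =
        H.toCStarRed (check (𝒢 := 𝒢) F) + H.toCStarRed (check (𝒢 := 𝒢) F') :=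
      Subtype.ext (H.totalRep.map_add (check (𝒢 := 𝒢) F) (check (𝒢 := 𝒢) F'))
    (congrArg H.moduleRep h).trans (H.moduleRep.map_add' _ _)
  map_smul' c F :=
    have h : H.toCStarRed (check (𝒢 := 𝒢) (c • F)) = c • H.toCStarRed (check (𝒢 := 𝒢) F) :=
      Subtype.ext (H.totalRep.map_smul c (check (𝒢 := 𝒢) F))
    (congrArg H.moduleRep h).trans (H.moduleRep.map_smul' c _)

theorem rightConv_check (F : C_c(G, ℂ)) :
    H.rightConv (check (𝒢 := 𝒢) F) = H.moduleRep (H.toCStarRed F) :=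
  congrArg (fun F' => H.moduleRep (H.toCStarRed F')) (check_check F)

theorem rightConv_ofCc (F f : C_c(G, ℂ)) :
    (H.rightConv F).1 (H.ofCc f) = H.ofCc (H.convolve f F) := by
  refine Subtype.ext (lp.ext (funext fun u => ?_))
  refine (H.invL2_symm_regRep_sec (check (𝒢 := 𝒢) F) f u).trans ?_
  exact congrArg (fun F' => H.sec (H.convolve f F') u) (check_check F)

theorem norm_rightConv (F : C_c(G, ℂ)) : ‖H.rightConv F‖ = H.normRed F :=
  (H.norm_moduleRep _).trans ((H.norm_toCStarRed _).trans (H.normRed_check F))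

/-- `(F * F')^∨ = F'^∨ * F^∨`. -/
theorem check_convolve (F F' : C_c(G, ℂ)) :
    check (𝒢 := 𝒢) (H.convolve F F') =
      H.convolve (check (𝒢 := 𝒢) F') (check (𝒢 := 𝒢) F) := by
  ext x
  have h1 := H.conv_eq_integral_measS (check (𝒢 := 𝒢) F') (x := x)
    (map_continuous (check (𝒢 := 𝒢) F)).aestronglyMeasurable
  refine Eq.trans ?_ h1.symm
  -- With `t = y⁻¹`, `(F * F')(x⁻¹)` becomes `∫ F(y⁻¹) F'(y x⁻¹) dλ_{s(x)}(y)`, which is the kernel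
  -- form of `F'^∨ * F^∨` at `x`.
  have h2 := (H.measurePreserving_inv' (𝒢.s x)).integral_comp
    (𝒢.invHomeo.measurableEmbedding) (fun t => F t * F' (𝒢.mul (𝒢.inv t) (𝒢.inv x)))
  change ∫ t, F t * F' (𝒢.mul (𝒢.inv t) (𝒢.inv x)) ∂(H.meas (𝒢.r (𝒢.inv x))) = _
  rw [𝒢.r_inv, ← h2]
  refine integral_congr_ae ?_
  filter_upwards [H.ae_s (𝒢.s x)] with y hy
  change _ = F' (𝒢.inv (𝒢.mul x (𝒢.inv y))) * F (𝒢.inv y)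
  rw [𝒢.mul_inv_rev (by rw [𝒢.r_inv, hy]), mul_comm]

theorem rightConv_convolve (F F' : C_c(G, ℂ)) :
    H.rightConv (H.convolve F F') = H.rightConv F' * H.rightConv F := by
  have h : H.toCStarRed (check (𝒢 := 𝒢) (H.convolve F F')) =
      H.toCStarRed (check (𝒢 := 𝒢) F') * H.toCStarRed (check (𝒢 := 𝒢) F) := by
    rw [check_convolve]
    exact Subtype.ext (lp.ext (funext fun u => H.regRep_conv u (check F') (check F)))
  exact (congrArg H.moduleRep h).trans (H.moduleRep.map_mul' _ _)

theorem rightConv_invol (F : C_c(G, ℂ)) :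
    H.rightConv (invol (𝒢 := 𝒢) F) = star (H.rightConv F) := by
  have h : H.toCStarRed (check (𝒢 := 𝒢) (invol (𝒢 := 𝒢) F)) =
      star (H.toCStarRed (check (𝒢 := 𝒢) F)) :=
    -- `(F^*)^∨` and `(F^∨)^*` are definitionally the same function, so no rewriting is needed.
    Subtype.ext (lp.ext (funext fun u => H.regRep_invol u (check F)))
  exact (congrArg H.moduleRep h).trans (H.moduleRep.map_star' _)

/-! ### The image of the reduced C*-algebra -/

theorem isometry_moduleRep : Isometry H.moduleRep :=
  AddMonoidHomClass.isometry_of_norm _ H.norm_moduleRep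

/-- The image of the dense subspace `C_c(G)` is dense in the range and consists of operators `R_F`,
which gives one inclusion. For the other, the range contains every `R_F` and is closed, being the
isometric image of a complete space. -/
theorem range_moduleRep : Set.range H.moduleRep = closure (Set.range H.rightConv) := by
  refine Set.Subset.antisymm ?_ ?_
  · refine (H.isometry_moduleRep.continuous.range_subset_closure_image_dense
      H.denseRange_toCStarRed).trans (closure_mono ?_)
    rintro _ ⟨_, ⟨F, rfl⟩, rfl⟩
    exact ⟨_, H.rightConv_check F⟩
  · have hcl := H.isometry_moduleRep.isUniformInducing.isComplete_range.isClosed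
    refine closure_minimal ?_ hcl
    rintro _ ⟨F, rfl⟩
    exact ⟨_, rfl⟩

end HaarSystem
end

theorem mainTheorem8 {X G : Type*} [TopologicalSpace X] [TopologicalSpace G] [T2Space G]
    [LocallyCompactSpace G] [SecondCountableTopology G] [MeasurableSpace G] [BorelSpace G]
    (𝒢 : TopGroupoid X G) (H : HaarSystem 𝒢) :
    ∃ R : C_c(G, ℂ) →ₗ[ℂ] Adjointable C₀(X, ℂ) H.E2,
      (∀ F f : C_c(G, ℂ), (R F).1 (H.ofCc f) = H.ofCc (H.convolve f F)) ∧
      (∀ F, ‖R F‖ ≤ H.normI F) ∧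
      (∀ F F', R (H.convolve F F') = R F' * R F) ∧
      (∀ F, R (HaarSystem.invol (𝒢 := 𝒢) F) = star (R F)) ∧
      (∀ F, ‖R F‖ = H.normRed F) ∧
      ∃ Φ : H.CStarRed →⋆ₙₐ[ℂ] Adjointable C₀(X, ℂ) H.E2,
        (∀ F, Φ (H.toCStarRed F) = R (HaarSystem.check (𝒢 := 𝒢) F)) ∧
        Isometry Φ ∧ Set.range Φ = closure (Set.range R) :=
  ⟨H.rightConv, H.rightConv_ofCc,
    fun F => (H.norm_rightConv F).trans_le (H.normRed_le_normI F),
    H.rightConv_convolve, H.rightConv_invol, H.norm_rightConv,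
    H.moduleRep, fun F => (H.rightConv_check F).symm, H.isometry_moduleRep, H.range_moduleRep⟩
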